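/- Let $\epsilon_k$, $k\in\mathbb Z$, be i.i.d. random elements of a measurable space, let $\epsilon_0^\star$ be distributed as $\epsilon_0$ and independent of $(\epsilon_k)_{k\in\mathbb Z}$, and write $\mathcal F_i=(\ldots,\epsilon_{i-1},\epsilon_i)$ and, for $i\ge 0$, $\mathcal F_i^\star=(\ldots,\epsilon_{-2},\epsilon_{-1},\epsilon_0^\star,\epsilon_1,\ldots,\epsilon_i)$. Let $e_{i,n}=G_n(\mathcal F_i)$ with measurable real-valued $G_n$. Let $\iota_{1,n}(u;\mathcal F_i)=\mathrm{pr}(e_{i+1,n}>u\mid\mathcal F_i)$, computed from a regular conditional distribution, and $\iota^{(q)}_{1,n}(u;\mathcal F_i)=\partial^q\iota_{1,n}(u;\mathcal F_i)/\partial u^q$. Write $\|X\|=\{E(|X|^2)\}^{1/2}$ for random variables and $|\cdot|$ for the Euclidean norm. Let $\alpha_n\to0$ with $n\alpha_n\to\infty$. Let $x_{i,n}\in\mathbb R^p$, $1\le i\le n$, be deterministic with $\Sigma_n=n^{-1}\sum_{i=1}^n x_{i,n}x_{i,n}^\top$ non-singular for all large $n$, and put $z_{i,n}=\Sigma_n^{-1/2}x_{i,n}$,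 $r_n=\max_{1\le i\le n}|z_{i,n}|$ and $\nu_n(q)=\sum_{i=1}^n|z_{i,n}|^q$. Let $\gamma_{i,n}$ be constants for which there are $0<c_{\gamma,1}\le c_{\gamma,2}<\infty$ with $c_{\gamma,1}\le\gamma_{i,n}\le c_{\gamma,2}$ for all $1\le i\le n$ and all large $n$. With $\psi_{1-\alpha}(u)=(1-\alpha)-\mathbf 1\{u\le0\}$ let $$N_n(\varphi)=\sum_{i=1}^n\Big[E\{\psi_{1-\alpha_n}(\gamma_{i,n}e_{i,n}-z_{i,n}^\top\varphi)\mid\mathcal F_{i-1}\}-E\{\psi_{1-\alpha_n}(\gamma_{i,n}e_{i,n}-z_{i,n}^\top\varphi)\}\Big]z_{i,n},\qquad\varphi\in\mathbb R^p,$$ where, for all $\varphi$ simultaneously, the conditional expectations are computed from one regular conditional distribution of $e_{i,n}$ given $\mathcal F_{i-1}$. Assume that there is an $\varepsilon_0>0$ such that, for all large $n$ and every $i\ge0$, almost surely $u\mapsto\iota_{1,n}(u;\mathcal F_i)$ is $p$ times differentiable at every $|u|\le\varepsilon_0$, and that for $q=1,\ldots,p$ we have $\sup_{|\varepsilon|\le\varepsilon_0}\|\iota^{(q)}_{1,n}(\varepsilon;\mathcal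 F_i)\|<\infty$ for all large $n$ and every $i\ge 0$, and $$\sum_{i=0}^\infty\sup_{|\varepsilon|\le\varepsilon_0}\Big\|E\{\iota^{(q)}_{1,n}(\varepsilon;\mathcal F_i)\mid\mathcal F_0\}-E\{\iota^{(q)}_{1,n}(\varepsilon;\mathcal F_i^\star)\mid\mathcal F_0^\star\}\Big\|=O(\alpha_n^{1/2})\qquad(n\to\infty).$$ Then for every sequence $\delta_n>0$ with $\delta_nr_n=o(1)$, $$\Big\|\sup_{|\varphi|\le\delta_n}|N_n(\varphi)-N_n(0)|\Big\|=O\big[\delta_n\{\alpha_n\nu_n(4)\}^{1/2}\big]\qquad(n\to\infty).$$ -/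

import Mathlib

open MeasureTheory ProbabilityTheory Filter Topology
open scoped ENNReal MatrixOrder

noncomputable section

namespace HighQuantile

variable {Ω S : Type*} [MeasurableSpace Ω] [MeasurableSpace S] {p : ℕ}

/-- The input `ℱ_i = (…, ε_{i-1}, ε_i)`, listed backwards in time: entry `j` is `ε_{i-j}`. -/
def past (ε : ℤ → Ω → S) (i : ℤ) (ω : Ω) : ℕ → S := fun j => ε (i - j) ω

/-- The innovations with the one at time zero replaced by `ε'`; the past of this sequence
is the coupled input `ℱ_i^⋆`. -/
def coupled (ε : ℤ → Ω → S) (ε' : Ω → S) : ℤ → Ω → S := Function.update ε 0 ε'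

/-- The output `e_i = g(ℱ_i)` of the system `g`. -/
def output (g : (ℕ → S) → ℝ) (ε : ℤ → Ω → S) (i : ℤ) (ω : Ω) : ℝ := g (past ε i ω)

/-- The σ-algebra on `Ω` generated by the input `ℱ_i`. -/
@[reducible] def pastSigma (ε : ℤ → Ω → S) (i : ℤ) : MeasurableSpace Ω :=
  MeasurableSpace.comap (past ε i) inferInstance

/-- The regular conditional distribution of `e_{i+1}` given `ℱ_i`. -/
def condLaw (P : Measure Ω) [IsFiniteMeasure P] (g : (ℕ → S) → ℝ) (ε : ℤ → Ω → S) (i : ℤ) :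
    Kernel (ℕ → S) ℝ :=
  condDistrib (output g ε (i + 1)) (past ε i) P

/-- The conditional tail probability `ι(u; h) = pr(e_{i+1} > u ∣ ℱ_i = h)`. -/
def iota (P : Measure Ω) [IsFiniteMeasure P] (g : (ℕ → S) → ℝ) (ε : ℤ → Ω → S) (i : ℤ)
    (h : ℕ → S) (u : ℝ) : ℝ :=
  (condLaw P g ε i h).real (Set.Ioi u)

/-- The derivative `ι^{(q)}(u; h) = ∂^q ι(u; h) / ∂u^q`. -/
def iotaDeriv (P : Measure Ω) [IsFiniteMeasure P] (g : (ℕ → S) → ℝ) (ε : ℤ → Ω → S) (i : ℤ)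
    (q : ℕ) (h : ℕ → S) (u : ℝ) : ℝ :=
  iteratedDeriv q (iota P g ε i h) u

/-- `E{ι^{(q)}(u; ℱ_i) ∣ ℱ_0} - E{ι^{(q)}(u; ℱ_i^⋆) ∣ ℱ_0^⋆}`. -/
def predictiveGap (P : Measure Ω) [IsFiniteMeasure P] (g : (ℕ → S) → ℝ) (ε : ℤ → Ω → S)
    (ε' : Ω → S) (q : ℕ) (i : ℕ) (u : ℝ) : Ω → ℝ :=
  P[fun ω => iotaDeriv P g ε i q (past ε i ω) u | pastSigma ε 0]
    - P[fun ω => iotaDeriv P g ε i q (past (coupled ε ε') i ω) u | pastSigma (coupled ε ε') 0]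

/-- `ψ_{1-a}(u) = (1 - a) - 1{u ≤ 0}`. -/
def psi (a u : ℝ) : ℝ := (1 - a) - Set.indicator (Set.Iic 0) (fun _ => (1 : ℝ)) u

/-- The Gram matrix `Σ_n = n⁻¹ ∑_{i=1}^n x_i x_iᵀ`. -/
def gram (n : ℕ) (x : ℕ → EuclideanSpace ℝ (Fin p)) : Matrix (Fin p) (Fin p) ℝ :=
  (n : ℝ)⁻¹ • ∑ i ∈ Finset.Icc 1 n, Matrix.vecMulVec (x i).ofLp (x i).ofLp

/-- The rescaled design `z_i = Σ_n^{-1/2} x_i`. -/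
def rescaled (n : ℕ) (x : ℕ → EuclideanSpace ℝ (Fin p)) (i : ℕ) : EuclideanSpace ℝ (Fin p) :=
  WithLp.toLp 2 (Matrix.mulVec (CFC.sqrt (gram n x))⁻¹ (x i).ofLp)

/-- `r_n = max_{1 ≤ i ≤ n} |z_i|`. -/
def maxNorm (n : ℕ) (z : ℕ → EuclideanSpace ℝ (Fin p)) : ℝ :=
  ((Finset.Icc 1 n).sup fun i => ‖z i‖₊ : NNReal)

/-- `ν_n(q) = ∑_{i=1}^n |z_i|^q`. -/
def nu (n : ℕ) (z : ℕ → EuclideanSpace ℝ (Fin p)) (q : ℕ) : ℝ :=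
  ∑ i ∈ Finset.Icc 1 n, ‖z i‖ ^ q

/-- The remainder
`N_n(φ) = ∑_{i=1}^n [E{ψ_{1-a}(γ_i e_i - z_iᵀφ) ∣ ℱ_{i-1}} - E{ψ_{1-a}(γ_i e_i - z_iᵀφ)}] z_i`.
The conditional expectations are integrals against the regular conditional distribution of `e_i`
given `ℱ_{i-1}`, one version for all `φ`, so that a supremum over `φ` makes sense. -/
def remainder (P : Measure Ω) [IsFiniteMeasure P] (g : (ℕ → S) → ℝ) (ε : ℤ → Ω → S)
    (a : ℝ) (n : ℕ) (γ : ℕ → ℝ) (z : ℕ → EuclideanSpace ℝ (Fin p))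
    (φ : EuclideanSpace ℝ (Fin p)) (ω : Ω) : EuclideanSpace ℝ (Fin p) :=
  ∑ i ∈ Finset.Icc 1 n,
    ((∫ y, psi a (γ i * y - inner ℝ (z i) φ)
        ∂(condLaw P g ε ((i : ℤ) - 1) (past ε ((i : ℤ) - 1) ω)))
      - ∫ ω', psi a (γ i * output g ε i ω' - inner ℝ (z i) φ) ∂P) • z i

end HighQuantile

end

/-! Integrating `psi` against the conditional law turns the `i`-th summand of the remainder into a
centred conditional tail probability, evaluated at `z_iᵀφ/γ_i`, times `z_i`. Each coordinate of
`N_n(φ) - N_n(0)` is thus a weighted sum of increments of random smooth functions of the linear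
forms `∑_j φ_j a_{ij}`, where `a_{ij} = z_{ij}/γ_i`.

To take the supremum inside the norm, the coordinates of `φ` are switched on one at a time. Each
change is the integral over at most `[-δ, δ]` of a sum of first derivatives with the extra weight
`a_{ik}`. The supremum over the coordinates already switched on is absorbed by the same device, at
the cost of one more derivative per coordinate, so orders up to `p` suffice. By Minkowski's
inequality only sums at deterministic points remain (`exists_majorant_increment`).

Such a sum is split by lag into martingale differences (`eLpNorm_sum_sub_integral_le`). At one lag
the terms are orthogonal, which gives `√(∑ c_i²)`. Stationarity and coupling bound the projection at
lag `m` by the `m`-th predictive gap (`eLpNorm_proj_shift`, `eLpNorm_proj_le_coupled`), and the gaps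
sum to `O(√α_n)`. The first integral contributes `δ_n` and weights `z_{il} a_{ik}`, whose squares
sum to at most `ν_n(4)/c₁²`. Further integrals only contribute factors `1 + 2δ_n r_n/c₁`, which stay
bounded. -/

namespace HighQuantile

/-! ### Martingale decomposition by lag -/

section Projections

variable {Ω : Type*} {m0 : MeasurableSpace Ω} {P : Measure Ω}

lemma eLpNorm_two_sq {E : Type*} [TopologicalSpace E] [ContinuousENorm E] (f : Ω → E) :
    eLpNorm f 2 P ^ 2 = ∫⁻ ω, ‖f ω‖ₑ ^ 2 ∂P := by
  have h := eLpNorm_nnreal_pow_eq_lintegral (f := f) (μ := P) (p := 2) (by norm_num)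
  simpa using h

lemma sq_eLpNorm_two_eq_ofReal {f : Ω → ℝ} (hf : MemLp f 2 P) :
    eLpNorm f 2 P ^ 2 = ENNReal.ofReal (∫ ω, f ω ^ 2 ∂P) := by
  rw [eLpNorm_two_sq, ofReal_integral_eq_lintegral_ofReal hf.integrable_sq
    (ae_of_all _ fun ω => sq_nonneg _)]
  refine lintegral_congr fun ω => ?_
  rw [← sq_abs, ENNReal.ofReal_pow (abs_nonneg _), Real.enorm_eq_ofReal_abs]

/-- The conditional variance is at most the conditional second moment; integrate. -/
lemma eLpNorm_sub_condExp_le [IsProbabilityMeasure P] {m : MeasurableSpace Ω} (hm : m ≤ m0)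
    {Z : Ω → ℝ} (hZ : MemLp Z 2 P) : eLpNorm (Z - P[Z | m]) 2 P ≤ eLpNorm Z 2 P := by
  have hc : MemLp (P[Z | m]) 2 P := hZ.condExp (by norm_num)
  have hs : MemLp (Z - P[Z | m]) 2 P := hZ.sub hc
  rw [← ENNReal.pow_le_pow_left_iff two_ne_zero, sq_eLpNorm_two_eq_ofReal hs,
    sq_eLpNorm_two_eq_ofReal hZ]
  apply ENNReal.ofReal_le_ofReal
  have h1 : ∫ ω, (Z - P[Z | m]) ω ^ 2 ∂P = ∫ ω, Var[Z; P | m] ω ∂P := (integral_condExp hm).symm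
  have h2 : ∫ ω, Z ω ^ 2 ∂P = ∫ ω, P[Z ^ 2 | m] ω ∂P := (integral_condExp hm).symm
  rw [h1, h2]
  exact integral_mono_ae integrable_condVar integrable_condExp (condVar_ae_le_condExp_sq hm hZ)

/-- The conditional expectation is the best approximation in mean square. -/
lemma eLpNorm_sub_condExp_le_sub [IsProbabilityMeasure P] {m : MeasurableSpace Ω} (hm : m ≤ m0)
    {Z Y : Ω → ℝ} (hZ : MemLp Z 2 P) (hY : StronglyMeasurable[m] Y) :
    eLpNorm (Z - P[Z | m]) 2 P ≤ eLpNorm (Z - Y) 2 P := by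
  by_cases h : eLpNorm (Z - Y) 2 P = ∞
  · simp [h]
  have hZY : MemLp (Z - Y) 2 P :=
    ⟨hZ.aestronglyMeasurable.sub (hY.mono hm).aestronglyMeasurable, lt_top_iff_ne_top.2 h⟩
  have hY2 : MemLp Y 2 P := by simpa using hZ.sub hZY
  have hYi := hY2.integrable (by norm_num)
  refine le_trans (le_of_eq (eLpNorm_congr_ae ?_)) (eLpNorm_sub_condExp_le hm hZY)
  filter_upwards [condExp_sub (hZ.integrable (by norm_num)) hYi m] with ω hω
  rw [condExp_of_stronglyMeasurable hm hY hYi] at hω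
  simp only [Pi.sub_apply] at hω ⊢
  rw [hω]; ring

lemma eLpNorm_sum_le_of_orthogonal {ι : Type*} (s : Finset ι) (c : ι → ℝ) {U : ι → Ω → ℝ}
    (hU : ∀ i ∈ s, MemLp (U i) 2 P)
    (horth : ∀ i ∈ s, ∀ j ∈ s, i ≠ j → ∫ ω, U i ω * U j ω ∂P = 0)
    {θ : ℝ≥0∞} (hθ : ∀ i ∈ s, eLpNorm (U i) 2 P ≤ θ) :
    eLpNorm (fun ω => ∑ i ∈ s, c i * U i ω) 2 P ≤ ENNReal.ofReal √(∑ i ∈ s, c i ^ 2) * θ := by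
  have hmem : MemLp (fun ω => ∑ i ∈ s, c i * U i ω) 2 P :=
    memLp_finsetSum s fun i hi => (hU i hi).const_mul (c i)
  have hint : ∫ ω, (∑ i ∈ s, c i * U i ω) ^ 2 ∂P = ∑ i ∈ s, c i ^ 2 * ∫ ω, U i ω ^ 2 ∂P := by
    have hij : ∀ i ∈ s, ∀ j ∈ s, Integrable (fun ω => U i ω * U j ω) P := fun i hi j hj =>
      (hU i hi).integrable_mul (hU j hj)
    have : ∀ ω, (∑ i ∈ s, c i * U i ω) ^ 2
        = ∑ i ∈ s, ∑ j ∈ s, (c i * c j) * (U i ω * U j ω) := by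
      intro ω
      rw [sq, Finset.sum_mul_sum]
      exact Finset.sum_congr rfl fun i _ => Finset.sum_congr rfl fun j _ => by ring
    simp_rw [this]
    rw [integral_finsetSum _ fun i hi => integrable_finsetSum _ fun j hj =>
      (hij i hi j hj).const_mul _]
    refine Finset.sum_congr rfl fun i hi => ?_
    rw [integral_finsetSum _ fun j hj => (hij i hi j hj).const_mul _]
    rw [Finset.sum_eq_single i]
    · rw [integral_const_mul]; simp only [sq]
    · intro j hj hne
      rw [integral_const_mul, horth i hi j hj hne.symm, mul_zero]
    · exact fun h => absurd hi h
  rw [← ENNReal.pow_le_pow_left_iff two_ne_zero, sq_eLpNorm_two_eq_ofReal hmem, hint, mul_pow,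
    ← ENNReal.ofReal_pow (Real.sqrt_nonneg _), Real.sq_sqrt (Finset.sum_nonneg fun i _ => sq_nonneg _),
    ENNReal.ofReal_sum_of_nonneg fun i _ => mul_nonneg (sq_nonneg _)
      (integral_nonneg fun ω => sq_nonneg _),
    ENNReal.ofReal_sum_of_nonneg fun i _ => sq_nonneg _, Finset.sum_mul]
  refine Finset.sum_le_sum fun i hi => ?_
  rw [ENNReal.ofReal_mul (sq_nonneg _), ← sq_eLpNorm_two_eq_ofReal (hU i hi)]
  gcongr
  exact hθ i hi

/-- The projection `E(X ∣ 𝓕_k) - E(X ∣ 𝓕_{k-1})`. -/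
noncomputable def proj (P : Measure Ω) (𝓕 : ℤ → MeasurableSpace Ω) (k : ℤ) (X : Ω → ℝ) : Ω → ℝ :=
  P[X | 𝓕 k] - P[X | 𝓕 (k - 1)]

lemma memLp_proj {𝓕 : ℤ → MeasurableSpace Ω} {X : Ω → ℝ} (hX : MemLp X 2 P) (k : ℤ) :
    MemLp (proj P 𝓕 k X) 2 P :=
  (hX.condExp (by norm_num)).sub (hX.condExp (by norm_num))

/-- The earlier projection is `𝓕 (l - 1)`-measurable and the later one has conditional mean zero
given `𝓕 (l - 1)`. The projected variables may differ, as they do for two summands at one lag. -/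
lemma integral_proj_mul_proj [IsProbabilityMeasure P] {𝓕 : ℤ → MeasurableSpace Ω}
    (hmono : Monotone 𝓕) (hle : ∀ k, 𝓕 k ≤ m0) {X Y : Ω → ℝ} (hX : MemLp X 2 P)
    (hY : MemLp Y 2 P) {k l : ℤ} (hkl : k < l) :
    ∫ ω, proj P 𝓕 k X ω * proj P 𝓕 l Y ω ∂P = 0 := by
  have hm : StronglyMeasurable[𝓕 (l - 1)] (proj P 𝓕 k X) :=
    (stronglyMeasurable_condExp.mono (hmono (by omega))).sub
      (stronglyMeasurable_condExp.mono (hmono (by omega)))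
  have hYl := memLp_proj (𝓕 := 𝓕) hY l
  have hprod : Integrable (proj P 𝓕 k X * proj P 𝓕 l Y) P := (memLp_proj hX k).integrable_mul hYl
  have hzero : P[proj P 𝓕 l Y | 𝓕 (l - 1)] =ᵐ[P] 0 := by
    have h1 := condExp_sub (μ := P) (f := P[Y | 𝓕 l]) (g := P[Y | 𝓕 (l - 1)])
      integrable_condExp integrable_condExp (𝓕 (l - 1))
    have h2 := condExp_condExp_of_le (f := Y) (μ := P) (hmono (show l - 1 ≤ l by omega)) (hle l)
    have h3 : P[P[Y | 𝓕 (l - 1)] | 𝓕 (l - 1)] = P[Y | 𝓕 (l - 1)] :=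
      condExp_of_stronglyMeasurable (hle _) stronglyMeasurable_condExp integrable_condExp
    filter_upwards [h1, h2] with ω h1 h2
    rw [proj, h1, Pi.sub_apply, h2, h3, sub_self]; rfl
  have h := condExp_mul_of_stronglyMeasurable_left hm hprod (hYl.integrable (by norm_num))
  calc ∫ ω, proj P 𝓕 k X ω * proj P 𝓕 l Y ω ∂P
      = ∫ ω, P[proj P 𝓕 k X * proj P 𝓕 l Y | 𝓕 (l - 1)] ω ∂P := (integral_condExp (hle _)).symm
    _ = ∫ ω, (0 : ℝ) ∂P := by
        refine integral_congr_ae ?_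
        filter_upwards [h, hzero] with ω h hz
        rw [h, Pi.mul_apply, hz]; simp
    _ = 0 := by simp

lemma sum_range_proj {𝓕 : ℤ → MeasurableSpace Ω} (X : Ω → ℝ) (k : ℤ) (M : ℕ) :
    ∑ m ∈ Finset.range M, proj P 𝓕 (k - m) X = P[X | 𝓕 k] - P[X | 𝓕 (k - M)] := by
  induction M with
  | zero => simp
  | succ M ih =>
    rw [Finset.sum_range_succ, ih, proj]
    push_cast
    rw [sub_sub k (M : ℤ) 1]
    abel

/-- A weighted sum of adapted variables is bounded in mean square by the sum over the lags of the
norms of the projections. -/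
theorem eLpNorm_sum_sub_integral_le [IsProbabilityMeasure P] {𝓕 : ℤ → MeasurableSpace Ω}
    (hmono : Monotone 𝓕) (hle : ∀ k, 𝓕 k ≤ m0) {ι : Type*} (s : Finset ι) (τ : ι → ℤ)
    (hτ : Function.Injective τ) (c : ι → ℝ)
    {X : ι → Ω → ℝ} (hX : ∀ i ∈ s, MemLp (X i) 2 P)
    (hadapt : ∀ i ∈ s, StronglyMeasurable[𝓕 (τ i)] (X i))
    (htail : ∀ i ∈ s, Tendsto (fun M : ℕ =>
      eLpNorm (fun ω => P[X i | 𝓕 (τ i - M)] ω - ∫ ω', X i ω' ∂P) 1 P) atTop (𝓝 0))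
    {θ : ℕ → ℝ≥0∞} (hθ : ∀ i ∈ s, ∀ m : ℕ, eLpNorm (proj P 𝓕 (τ i - m) (X i)) 2 P ≤ θ m) :
    eLpNorm (fun ω => ∑ i ∈ s, c i * (X i ω - ∫ ω', X i ω' ∂P)) 2 P
      ≤ ENNReal.ofReal √(∑ i ∈ s, c i ^ 2) * ∑' m, θ m := by
  set W : Ω → ℝ := fun ω => ∑ i ∈ s, c i * (X i ω - ∫ ω', X i ω' ∂P) with hW
  set R : ℕ → Ω → ℝ := fun M ω =>
    ∑ i ∈ s, c i * (P[X i | 𝓕 (τ i - M)] ω - ∫ ω', X i ω' ∂P) with hR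
  have hXm : ∀ i ∈ s, AEStronglyMeasurable (X i) P := fun i hi => (hX i hi).1
  have hWm : AEStronglyMeasurable W P :=
    Finset.aestronglyMeasurable_fun_sum s fun i hi =>
      ((hXm i hi).sub aestronglyMeasurable_const).const_mul (c i)
  have hRmi : ∀ (M : ℕ) (i : ι), AEStronglyMeasurable
      (fun ω => P[X i | 𝓕 (τ i - M)] ω - ∫ ω', X i ω' ∂P) P := fun M i =>
    (stronglyMeasurable_condExp.mono (hle _)).aestronglyMeasurable.sub aestronglyMeasurable_const
  have hRm : ∀ M, AEStronglyMeasurable (R M) P := fun M =>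
    Finset.aestronglyMeasurable_fun_sum s fun i hi => (hRmi M i).const_mul (c i)
  have hbound : ∀ M, eLpNorm (W - R M) 2 P
      ≤ ENNReal.ofReal √(∑ i ∈ s, c i ^ 2) * ∑' m, θ m := by
    intro M
    -- Telescoping over `M` lags; by adaptedness the conditional expectation at lag zero is `X i`
    -- itself.
    have hEq : W - R M = ∑ m ∈ Finset.range M,
        fun ω => ∑ i ∈ s, c i * proj P 𝓕 (τ i - m) (X i) ω := by
      ext ω
      simp only [Finset.sum_apply, Pi.sub_apply, hW, hR]
      rw [Finset.sum_comm, ← Finset.sum_sub_distrib]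
      refine Finset.sum_congr rfl fun i hi => ?_
      have h := congrFun (sum_range_proj (P := P) (𝓕 := 𝓕) (X i) (τ i) M) ω
      rw [condExp_of_stronglyMeasurable (hle _) (hadapt i hi)
        ((hX i hi).integrable (by norm_num))] at h
      rw [← Finset.mul_sum, ← Finset.sum_apply, h, Pi.sub_apply]
      ring
    rw [hEq]
    refine (eLpNorm_sum_le (fun m _ => Finset.aestronglyMeasurable_fun_sum s fun i hi =>
      ((memLp_proj (hX i hi) _).1).const_mul (c i)) (by norm_num)).trans ?_
    refine (Finset.sum_le_sum fun m _ => eLpNorm_sum_le_of_orthogonal s c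
      (θ := θ m) (fun i hi => memLp_proj (hX i hi) _) ?_ (fun i hi => hθ i hi m)).trans ?_
    · intro i hi j hj hij
      -- At a fixed lag, distinct indices project at distinct times because `τ` is injective.
      rcases lt_or_gt_of_ne (hτ.ne hij) with h | h
      · exact integral_proj_mul_proj hmono hle (hX i hi) (hX j hj) (by omega)
      · simp_rw [mul_comm (proj P 𝓕 (τ i - m) (X i) _)]
        exact integral_proj_mul_proj hmono hle (hX j hj) (hX i hi) (by omega)
    · rw [← Finset.mul_sum]
      gcongr
      exact ENNReal.sum_le_tsum _
  have hR0 : Tendsto (fun M => eLpNorm (R M - 0) 1 P) atTop (𝓝 0) := by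
    have hlim : Tendsto (fun M : ℕ => ∑ i ∈ s, ‖c i‖ₑ *
        eLpNorm (fun ω => P[X i | 𝓕 (τ i - M)] ω - ∫ ω', X i ω' ∂P) 1 P) atTop (𝓝 0) := by
      have : (0 : ℝ≥0∞) = ∑ i ∈ s, ‖c i‖ₑ * 0 := by simp
      rw [this]
      exact tendsto_finsetSum _ fun i hi =>
        ENNReal.Tendsto.const_mul (htail i hi) (Or.inr enorm_ne_top)
    refine tendsto_of_tendsto_of_tendsto_of_le_of_le tendsto_const_nhds hlim
      (fun _ => bot_le) fun M => ?_
    rw [sub_zero]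
    have : R M = ∑ i ∈ s, c i • fun ω => P[X i | 𝓕 (τ i - M)] ω - ∫ ω', X i ω' ∂P := by
      ext ω; simp [hR]
    rw [this]
    refine (eLpNorm_sum_le (fun i _ => (hRmi M i).const_smul (c i)) le_rfl).trans ?_
    exact Finset.sum_le_sum fun i _ => (eLpNorm_const_smul _ _ _ _).le
  -- Convergence of `R M` in `L¹` is enough: it gives almost sure convergence along a subsequence,
  -- and Fatou's lemma carries the uniform `L²` bound to `W`.
  obtain ⟨ns, hns, hae⟩ := (tendstoInMeasure_of_tendsto_eLpNorm one_ne_zero hRm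
    aestronglyMeasurable_zero hR0).exists_seq_tendsto_ae
  refine (Lp.eLpNorm_lim_le_liminf_eLpNorm (f := fun k => W - R (ns k))
    (fun k => hWm.sub (hRm _)) W ?_).trans ?_
  · filter_upwards [hae] with ω hω
    simpa using (tendsto_const_nhds (x := W ω)).sub hω
  · exact (liminf_le_liminf (Eventually.of_forall fun k => hbound (ns k))).trans (by simp)

end Projections

/-! ### Stationarity, coupling and the remote past -/

section Inputs

set_option linter.unusedSectionVars false

variable {Ω S : Type*} [MeasurableSpace Ω] [MeasurableSpace S] {P : Measure Ω}

/-- Drop the `m` most recent entries of an input. -/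
def drop (m : ℕ) (h : ℕ → S) : ℕ → S := fun j => h (j + m)

/-- Put `s` in front of an input. -/
def cons (s : S) (h : ℕ → S) : ℕ → S
  | 0 => s
  | j + 1 => h j

lemma measurable_drop (m : ℕ) : Measurable (drop m : (ℕ → S) → ℕ → S) :=
  measurable_pi_lambda _ fun j => measurable_pi_apply (j + m)

lemma measurable_cons : Measurable fun x : S × (ℕ → S) => cons x.1 x.2 := by
  refine measurable_pi_lambda _ fun j => ?_
  cases j with
  | zero => exact measurable_fst
  | succ j => exact (measurable_pi_apply j).comp measurable_snd

lemma measurable_past {ε : ℤ → Ω → S} (hε : ∀ k, Measurable (ε k)) (i : ℤ) :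
    Measurable (past ε i) :=
  measurable_pi_lambda _ fun j => hε (i - j)

lemma drop_comp_past (ε : ℤ → Ω → S) (i : ℤ) (m : ℕ) : drop m ∘ past ε i = past ε (i - m) := by
  ext ω j
  have h : i - ((j + m : ℕ) : ℤ) = i - m - j := by push_cast; ring
  simp only [drop, past, Function.comp, h]

lemma pastSigma_le {ε : ℤ → Ω → S} (hε : ∀ k, Measurable (ε k)) (i : ℤ) :
    pastSigma ε i ≤ ‹MeasurableSpace Ω› := (measurable_past hε i).comap_le

lemma pastSigma_sub (ε : ℤ → Ω → S) (i : ℤ) (m : ℕ) :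
    pastSigma ε (i - m) = MeasurableSpace.comap (drop m ∘ past ε i) inferInstance := by
  rw [drop_comp_past]

lemma pastSigma_mono (ε : ℤ → Ω → S) : Monotone (pastSigma ε) := by
  intro i k hik
  obtain ⟨m, rfl⟩ : ∃ m : ℕ, i = k - m := ⟨(k - i).toNat, by omega⟩
  rw [pastSigma_sub, ← MeasurableSpace.comap_comp]
  exact MeasurableSpace.comap_mono (measurable_drop m).comap_le

lemma pastSigma_eq_iSup (ε : ℤ → Ω → S) (i : ℤ) :
    pastSigma ε i = ⨆ j : ℕ, MeasurableSpace.comap (ε (i - j)) inferInstance := by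
  rw [pastSigma, MeasurableSpace.pi, MeasurableSpace.comap_iSup]
  simp_rw [MeasurableSpace.comap_comp]
  rfl

lemma map_past {ε : ℤ → Ω → S} (hε : ∀ k, Measurable (ε k)) (hindep : iIndepFun ε P)
    {μ : Measure S} (hlaw : ∀ k, P.map (ε k) = μ) (i : ℤ) :
    P.map (past ε i) = Measure.infinitePi fun _ : ℕ => μ := by
  have hinj : Function.Injective fun j : ℕ => i - (j : ℤ) := fun a b h => by
    simp only at h; omega
  have h := (hindep.precomp hinj).map_fun_eq_infinitePi_map fun j => hε _
  simp only [hlaw] at h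
  exact h

lemma past_coupled_zero (ε : ℤ → Ω → S) (ε' : Ω → S) (ω : Ω) :
    past (coupled ε ε') 0 ω = cons (ε' ω) (past ε (0 - 1) ω) := by
  ext j
  cases j with
  | zero => simp [past, coupled, cons]
  | succ j =>
    have h : (0 : ℤ) - ((j + 1 : ℕ) : ℤ) ≠ 0 := by omega
    have h' : (0 : ℤ) - ((j + 1 : ℕ) : ℤ) = 0 - 1 - j := by push_cast; ring
    simp only [past, coupled, cons, Function.update_of_ne h]
    rw [h']

/-- Conditional expectations of `f ∘ X` given `T ∘ X` depend on the law of `X` only. -/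
lemma condExp_comp_ae_eq {E F : Type*} [MeasurableSpace E] [MeasurableSpace F]
    [IsProbabilityMeasure P] {X : Ω → E} (hX : Measurable X) {T : E → F} (hT : Measurable T)
    {f : E → ℝ} (hf : Integrable f (P.map X)) {a : F → ℝ} (ha : Measurable a)
    (h : (P.map X)[f | MeasurableSpace.comap T inferInstance] =ᵐ[P.map X] a ∘ T) :
    P[f ∘ X | MeasurableSpace.comap (T ∘ X) inferInstance] =ᵐ[P] a ∘ T ∘ X := by
  have hprob : IsProbabilityMeasure (P.map X) := Measure.isProbabilityMeasure_map hX.aemeasurable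
  have haT : Integrable (a ∘ T) (P.map X) := (integrable_congr h).1 integrable_condExp
  have haX : Integrable (a ∘ T ∘ X) P := haT.comp_measurable hX
  refine (ae_eq_condExp_of_forall_setIntegral_eq (hT.comp hX).comap_le
    (hf.comp_measurable hX) (fun s _ _ => haX.integrableOn) ?_ ?_).symm
  · rintro s ⟨B, hB, rfl⟩ -
    have hTB : MeasurableSet (T ⁻¹' B) := hT hB
    have h1 : ∀ g : E → ℝ, AEStronglyMeasurable g (P.map X) →
        ∫ ω in T ∘ X ⁻¹' B, g (X ω) ∂P = ∫ x in T ⁻¹' B, g x ∂(P.map X) := fun g hg =>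
      (setIntegral_map hTB hg hX.aemeasurable).symm
    have e1 := h1 (a ∘ T) haT.aestronglyMeasurable
    have e2 := h1 f hf.aestronglyMeasurable
    simp only [Function.comp_apply] at e1 e2 ⊢
    rw [e1, e2, ← setIntegral_condExp hT.comap_le hf ⟨B, hB, rfl⟩]
    exact setIntegral_congr_ae hTB (h.mono fun x hx _ => hx.symm)
  · have hm : Measurable[MeasurableSpace.comap (T ∘ X) inferInstance] (a ∘ T ∘ X) :=
      ha.comp (comap_measurable (T ∘ X))
    exact hm.stronglyMeasurable.aestronglyMeasurable

/-- For inputs with law `Q`, the predictor at lag `m` is one measurable function of the input. -/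
lemma exists_predictor [IsProbabilityMeasure P] {ε : ℤ → Ω → S} (hε : ∀ k, Measurable (ε k))
    {Q : Measure (ℕ → S)} (hQ : ∀ i, P.map (past ε i) = Q) {f : (ℕ → S) → ℝ}
    (hf : Integrable f Q) (m : ℕ) :
    ∃ a : (ℕ → S) → ℝ, Measurable a ∧ ∀ i : ℤ,
      P[f ∘ past ε i | pastSigma ε (i - m)] =ᵐ[P] a ∘ past ε (i - m) := by
  have hsm : StronglyMeasurable[MeasurableSpace.comap (drop m) inferInstance]
      (Q[f | MeasurableSpace.comap (drop m) inferInstance]) := stronglyMeasurable_condExp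
  obtain ⟨a, ha, hEq⟩ := hsm.measurable.exists_eq_measurable_comp
  refine ⟨a, ha, fun i => ?_⟩
  rw [pastSigma_sub, ← drop_comp_past]
  rw [← hQ i] at hf hEq
  exact condExp_comp_ae_eq (measurable_past hε i) (measurable_drop m) hf ha (by rw [hEq])

/-- The predictors at lags `m` and `m + 1` are fixed functions of the input, so the projection is
one function of an input with law `Q`, whatever `i` is. Its norm depends on the lag only. -/
lemma eLpNorm_proj_shift [IsProbabilityMeasure P] {ε : ℤ → Ω → S} (hε : ∀ k, Measurable (ε k))
    {Q : Measure (ℕ → S)} (hQ : ∀ i, P.map (past ε i) = Q) {f : (ℕ → S) → ℝ}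
    (hf : Integrable f Q) (i : ℤ) (m : ℕ) :
    eLpNorm (proj P (pastSigma ε) (i - m) (f ∘ past ε i)) 2 P
      = eLpNorm (proj P (pastSigma ε) 0 (f ∘ past ε m)) 2 P := by
  obtain ⟨a, ha, hEa⟩ := exists_predictor hε hQ hf m
  obtain ⟨b, hb, hEb⟩ := exists_predictor hε hQ hf (m + 1)
  have key : ∀ i : ℤ, eLpNorm (proj P (pastSigma ε) (i - m) (f ∘ past ε i)) 2 P
      = eLpNorm (a - b ∘ drop 1) 2 Q := by
    intro i
    have hmeas : AEStronglyMeasurable (a - b ∘ drop 1) (P.map (past ε (i - m))) :=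
      (ha.sub (hb.comp (measurable_drop 1))).aestronglyMeasurable
    rw [← hQ (i - m), eLpNorm_map_measure hmeas (measurable_past hε _).aemeasurable]
    refine eLpNorm_congr_ae ?_
    have h1 := hEa i
    have h2 := hEb i
    have hidx : i - ((m + 1 : ℕ) : ℤ) = i - m - 1 := by push_cast; ring
    have hd : past ε (i - m - 1) = drop 1 ∘ past ε (i - m) := by
      rw [drop_comp_past]; rfl
    rw [hidx, hd] at h2
    filter_upwards [h1, h2] with ω h1 h2
    simp only [proj, Pi.sub_apply, Function.comp_apply] at h1 h2 ⊢
    rw [h1]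
    exact congrArg _ h2
  have h := key m
  rw [sub_self] at h
  rw [key i, h]

/-- The projection is bounded by the distance of the predictor from any function of the input with
the innovation at time zero replaced. -/
theorem eLpNorm_proj_le_coupled [IsProbabilityMeasure P] {ε : ℤ → Ω → S} {ε' : Ω → S}
    (hε : ∀ k, Measurable (ε k)) (hε' : Measurable ε') (hindep' : IndepFun ε' (fun ω k => ε k ω) P)
    {X : Ω → ℝ} (hX : MemLp X 2 P) {B : Ω → ℝ}
    (hB : StronglyMeasurable[pastSigma (coupled ε ε') 0] B) :
    eLpNorm (proj P (pastSigma ε) 0 X) 2 P ≤ eLpNorm (P[X | pastSigma ε 0] - B) 2 P := by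
  have hprob : IsProbabilityMeasure (P.map (past ε 0)) :=
    Measure.isProbabilityMeasure_map (measurable_past hε 0).aemeasurable
  have hprob' : IsProbabilityMeasure (P.map ε') :=
    Measure.isProbabilityMeasure_map hε'.aemeasurable
  obtain ⟨a, ha, h1⟩ := (stronglyMeasurable_condExp (m := pastSigma ε 0) (μ := P)
    (f := X)).measurable.exists_eq_measurable_comp
  obtain ⟨b, hb, h2⟩ := hB.measurable.exists_eq_measurable_comp
  have hA : MemLp (a ∘ past ε 0) 2 P := h1 ▸ hX.condExp (by norm_num)
  -- By the tower property the projection is the residual of the predictor given the input at time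
  -- `-1`.
  have hL : eLpNorm (proj P (pastSigma ε) 0 X) 2 P
      = eLpNorm (a ∘ past ε 0 - P[a ∘ past ε 0 | pastSigma ε (0 - 1)]) 2 P := by
    refine eLpNorm_congr_ae ?_
    have h3 := condExp_condExp_of_le (f := X) (μ := P)
      (pastSigma_mono ε (show (0 : ℤ) - 1 ≤ 0 by norm_num)) (pastSigma_le hε 0)
    rw [h1] at h3
    filter_upwards [h3] with ω h3
    rw [proj, Pi.sub_apply, Pi.sub_apply, h1, h3]
  have hR : P[X | pastSigma ε 0] - B
      = fun ω => a (past ε 0 ω) - b (cons (ε' ω) (drop 1 (past ε 0 ω))) := by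
    ext ω
    have hd := congrFun (drop_comp_past ε 0 1) ω
    simp only [Function.comp_apply, Nat.cast_one] at hd
    rw [Pi.sub_apply, h1, h2, Function.comp_apply, Function.comp_apply, past_coupled_zero, hd]
  rw [hL, hR, ← ENNReal.pow_le_pow_left_iff two_ne_zero]
  set L := eLpNorm (a ∘ past ε 0 - P[a ∘ past ε 0 | pastSigma ε (0 - 1)]) 2 P
  have hind : IndepFun ε' (past ε 0) P := by
    have hmeas : Measurable fun (h : ℤ → S) (j : ℕ) => h (0 - j) :=
      measurable_pi_lambda _ fun j => measurable_pi_apply _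
    exact hindep'.comp measurable_id hmeas
  have hprod : P.map (fun ω => (ε' ω, past ε 0 ω)) = (P.map ε').prod (P.map (past ε 0)) :=
    (indepFun_iff_map_prod_eq_prod_map_map hε'.aemeasurable
      (measurable_past hε 0).aemeasurable).1 hind
  have hker : Measurable fun x : S × (ℕ → S) => ‖a x.2 - b (cons x.1 (drop 1 x.2))‖ₑ ^ 2 := by
    refine Measurable.pow_const (Measurable.enorm ?_) _
    have hd : Measurable fun x : S × (ℕ → S) => (x.1, drop 1 x.2) :=
      measurable_fst.prodMk ((measurable_drop 1).comp measurable_snd)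
    exact (ha.comp measurable_snd).sub (hb.comp (measurable_cons.comp hd))
  -- With the replaced innovation frozen at `s`, the comparison function depends on the input at
  -- time `-1` only, so best approximation applies. Independence of `ε'` then allows averaging over
  -- `s`.
  have hs : ∀ s : S, L ^ 2 ≤ ∫⁻ h, ‖a h - b (cons s (drop 1 h))‖ₑ ^ 2 ∂(P.map (past ε 0)) := by
    intro s
    have hm : Measurable fun h : ℕ → S => ‖a h - b (cons s (drop 1 h))‖ₑ ^ 2 :=
      hker.comp measurable_prodMk_left
    rw [lintegral_map hm (measurable_past hε 0)]
    have hY : StronglyMeasurable[pastSigma ε (0 - 1)]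
        (fun ω => b (cons s (drop 1 (past ε 0 ω)))) := by
      have hd := pastSigma_sub ε 0 1
      rw [Nat.cast_one] at hd
      rw [hd]
      have hc : Measurable fun h : ℕ → S => b (cons s h) :=
        hb.comp (measurable_cons.comp measurable_prodMk_left)
      exact (hc.comp (comap_measurable (drop 1 ∘ past ε 0))).stronglyMeasurable
    have h := eLpNorm_sub_condExp_le_sub (pastSigma_le hε (0 - 1)) hA hY
    rw [← ENNReal.pow_le_pow_left_iff two_ne_zero] at h
    exact h.trans_eq (eLpNorm_two_sq _)
  calc L ^ 2 = ∫⁻ _, L ^ 2 ∂(P.map ε') := by simp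
    _ ≤ ∫⁻ s, ∫⁻ h, ‖a h - b (cons s (drop 1 h))‖ₑ ^ 2 ∂(P.map (past ε 0)) ∂(P.map ε') :=
        lintegral_mono hs
    _ = ∫⁻ x, ‖a x.2 - b (cons x.1 (drop 1 x.2))‖ₑ ^ 2 ∂((P.map ε').prod (P.map (past ε 0))) := by
        exact (lintegral_prod _ hker.aemeasurable).symm
    _ = _ := by
        rw [← hprod, lintegral_map hker (hε'.prodMk (measurable_past hε 0)), eLpNorm_two_sq]

/-- The remote past of independent innovations carries no information. -/
theorem tendsto_condExp_remote_past [IsProbabilityMeasure P] {ε : ℤ → Ω → S}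
    (hε : ∀ k, Measurable (ε k)) (hindep : iIndepFun ε P) (i : ℤ) {X : Ω → ℝ}
    (hX : Integrable X P) (hXm : StronglyMeasurable[pastSigma ε i] X) :
    Tendsto (fun M : ℕ => eLpNorm (fun ω => P[X | pastSigma ε (i - M)] ω - ∫ ω', X ω' ∂P) 1 P)
      atTop (𝓝 0) := by
  have hcle : ∀ k, MeasurableSpace.comap (ε k) inferInstance ≤ ‹MeasurableSpace Ω› :=
    fun k => (hε k).comap_le
  -- `𝒢 K` is generated by the `K + 1` newest innovations. It increases to the whole input and is
  -- independent of the input at time `i - (K + 1)`, hence the shift of the limit by one.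
  let 𝒢 : Filtration ℕ ‹MeasurableSpace Ω› :=
    { seq := fun K => ⨆ j ≤ K, MeasurableSpace.comap (ε (i - (j : ℕ))) inferInstance
      mono' := fun K L hKL => biSup_mono fun j hj => hj.trans hKL
      le' := fun K => iSup₂_le fun j _ => hcle _ }
  have hsup : ⨆ K, 𝒢 K = pastSigma ε i := by
    rw [pastSigma_eq_iSup]
    apply le_antisymm
    · exact iSup_le fun K => iSup₂_le fun j _ =>
        le_iSup (fun j : ℕ => MeasurableSpace.comap (ε (i - (j : ℕ))) inferInstance) j
    · exact iSup_le fun j => le_trans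
        (le_iSup₂ (f := fun (l : ℕ) (_ : l ≤ j) =>
          MeasurableSpace.comap (ε (i - (l : ℕ))) inferInstance) j le_rfl)
        (le_iSup (fun K => (𝒢 K : MeasurableSpace Ω)) j)
  have hlim := tendsto_eLpNorm_condExp (μ := P) (ℱ := 𝒢) X
  rw [hsup, condExp_of_stronglyMeasurable (pastSigma_le hε i) hXm hX] at hlim
  rw [← tendsto_add_atTop_iff_nat 1]
  refine tendsto_of_tendsto_of_tendsto_of_le_of_le tendsto_const_nhds hlim
    (fun _ => bot_le) fun K => ?_
  have hind : Indep (𝒢 K) (pastSigma ε (i - ((K + 1 : ℕ) : ℤ))) P := by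
    have h := indep_iSup_of_disjoint hcle hindep.iIndep
      (S := {k | i - (K : ℤ) ≤ k}) (T := {k | k < i - (K : ℤ)})
      (Set.disjoint_left.2 fun k hk hk' => (not_lt.2 hk : ¬ k < i - (K : ℤ)) hk')
    refine indep_of_indep_of_le_left (indep_of_indep_of_le_right h ?_) ?_
    · rw [pastSigma_eq_iSup]
      exact iSup_le fun j => le_iSup₂ (f := fun (k : ℤ) (_ : k ∈ {k : ℤ | k < i - (K : ℤ)}) =>
        MeasurableSpace.comap (ε k) inferInstance) _ (by simp only [Set.mem_ofPred_eq]; omega)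
    · exact iSup₂_le fun j hj => le_iSup₂ (f := fun (k : ℤ) (_ : k ∈ {k : ℤ | i - (K : ℤ) ≤ k}) =>
        MeasurableSpace.comap (ε k) inferInstance) _ (by simp only [Set.mem_ofPred_eq]; omega)
  have hconst := condExp_indep_eq (𝒢.le K) (pastSigma_le hε _)
    (stronglyMeasurable_condExp (f := X) (μ := P)) hind
  rw [integral_condExp (𝒢.le K)] at hconst
  have hsub := condExp_sub (μ := P) hX (integrable_condExp (m := 𝒢 K) (f := X))
    (pastSigma ε (i - ((K + 1 : ℕ) : ℤ)))
  -- Given the remote past, `E(X ∣ 𝒢 K)` averages to the mean of `X`. The deviation is therefore a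
  -- conditional expectation of `X - E(X ∣ 𝒢 K)`, and conditioning contracts `L¹`.
  calc eLpNorm (fun ω => P[X | pastSigma ε (i - ((K + 1 : ℕ) : ℤ))] ω - ∫ ω', X ω' ∂P) 1 P
      = eLpNorm (P[X - P[X | 𝒢 K] | pastSigma ε (i - ((K + 1 : ℕ) : ℤ))]) 1 P := by
        refine eLpNorm_congr_ae ?_
        filter_upwards [hconst, hsub] with ω h1 h2
        rw [h2, Pi.sub_apply, h1]
    _ ≤ eLpNorm (X - P[X | 𝒢 K]) 1 P := eLpNorm_condExp_le_eLpNorm _ le_rfl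
    _ = eLpNorm (P[X | 𝒢 K] - X) 1 P := eLpNorm_sub_comm _ _ _ _

end Inputs

/-! ### Measurable versions of derivatives, and the fundamental theorem after centring -/

section Derivatives

set_option linter.unusedSectionVars false

variable {E : Type*} [MeasurableSpace E]

/-- The `m`-th step of a sequence that tends to zero and points from `u` towards the origin. -/
noncomputable def inwardStep (m : ℕ) (u : ℝ) : ℝ :=
  if u ≤ 0 then 1 / ((m : ℝ) + 1) else -(1 / ((m : ℝ) + 1))

/-- A measurable version of the derivatives in the second variable: upper limits of difference
quotients along steps towards the origin. -/
noncomputable def measDeriv (F : E × ℝ → ℝ) : ℕ → E × ℝ → ℝ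
  | 0 => F
  | q + 1 => fun x => limsup (fun m : ℕ => (inwardStep m x.2)⁻¹ *
      (measDeriv F q (x.1, x.2 + inwardStep m x.2) - measDeriv F q x)) atTop

lemma measurable_inwardStep (m : ℕ) : Measurable (inwardStep m) :=
  Measurable.ite measurableSet_Iic measurable_const measurable_const

lemma measurable_measDeriv {F : E × ℝ → ℝ} (hF : Measurable F) (q : ℕ) :
    Measurable (measDeriv F q) := by
  induction q with
  | zero => exact hF
  | succ q ih =>
    refine Measurable.limsup fun m => ?_
    have hs : Measurable fun x : E × ℝ => inwardStep m x.2 :=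
      (measurable_inwardStep m).comp measurable_snd
    exact hs.inv.mul ((ih.comp (measurable_fst.prodMk (measurable_snd.add hs))).sub ih)

lemma tendsto_inwardStep (u : ℝ) : Tendsto (fun m => inwardStep m u) atTop (𝓝[≠] 0) := by
  have h := tendsto_one_div_add_atTop_nhds_zero_nat (𝕜 := ℝ)
  refine tendsto_nhdsWithin_iff.2 ⟨?_, Eventually.of_forall fun m => ?_⟩
  · unfold inwardStep
    split_ifs
    · exact h
    · simpa using h.neg
  · have : (1 : ℝ) / ((m : ℝ) + 1) ≠ 0 := by positivity
    unfold inwardStep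
    split_ifs
    · exact this
    · exact neg_ne_zero.2 this

/-- Inward steps keep difference quotients inside the closed interval even at its endpoints; only
there are the lower-order versions known to be the derivatives. -/
lemma eventually_add_inwardStep_mem {r u : ℝ} (hr : 0 < r) (hu : u ∈ Set.Icc (-r) r) :
    ∀ᶠ m in atTop, u + inwardStep m u ∈ Set.Icc (-r) r := by
  have h := (tendsto_one_div_add_atTop_nhds_zero_nat (𝕜 := ℝ)).eventually_lt_const hr
  filter_upwards [h] with m hm
  have hpos : (0 : ℝ) < 1 / ((m : ℝ) + 1) := by positivity
  obtain ⟨h1, h2⟩ := hu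
  unfold inwardStep
  split_ifs with h0
  · constructor <;> linarith
  · rw [not_le] at h0
    constructor <;> linarith

/-- Where a derivative exists, the difference quotients converge along any null sequence of nonzero
steps, so the upper limit is the derivative. -/
lemma measDeriv_eq_iteratedDeriv {F : E × ℝ → ℝ} {h : E} {r : ℝ} (hr : 0 < r) {p : ℕ}
    (hd : ∀ q < p, ∀ u ∈ Set.Icc (-r) r,
      DifferentiableAt ℝ (iteratedDeriv q fun v => F (h, v)) u)
    (q : ℕ) (hq : q ≤ p) (u : ℝ) (hu : u ∈ Set.Icc (-r) r) :
    measDeriv F q (h, u) = iteratedDeriv q (fun v => F (h, v)) u := by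
  induction q generalizing u with
  | zero => simp [measDeriv]
  | succ q ih =>
    refine Tendsto.limsup_eq ?_
    have hder := (hd q (by omega) u hu).hasDerivAt
    rw [← iteratedDeriv_succ] at hder
    have ht := (hasDerivAt_iff_tendsto_slope_zero.1 hder).comp (tendsto_inwardStep u)
    refine ht.congr' ?_
    filter_upwards [eventually_add_inwardStep_mem hr hu] with m hm
    simp only [Function.comp_apply, smul_eq_mul]
    rw [ih (by omega) _ hm, ih (by omega) u hu]

/-- Subtract the mean in the first variable. -/
noncomputable def centred (Q : Measure E) (D : E × ℝ → ℝ) (x : E × ℝ) : ℝ :=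
  D x - ∫ h, D (h, x.2) ∂Q

lemma measurable_centred (Q : Measure E) [SFinite Q] {D : E × ℝ → ℝ} (hD : Measurable D) :
    Measurable (centred Q D) := by
  have h : StronglyMeasurable fun u => ∫ h, D (h, u) ∂Q :=
    (hD.stronglyMeasurable).integral_prod_left'
  exact hD.sub (h.measurable.comp measurable_snd)

/-- Tonelli's theorem, with `L¹` bounded by `L²` on a probability space and an interval of finite
length. -/
lemma integrable_prod_of_eLpNorm_le {Q : Measure E} [IsProbabilityMeasure Q] {D : E × ℝ → ℝ}
    (hD : Measurable D) {r : ℝ} {B : ℝ≥0∞} (hB : B ≠ ∞)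
    (h : ∀ u ∈ Set.Icc (-r) r, eLpNorm (fun h => D (h, u)) 2 Q ≤ B) :
    Integrable D (Q.prod (volume.restrict (Set.Icc (-r) r))) := by
  refine ⟨hD.aestronglyMeasurable, ?_⟩
  rw [hasFiniteIntegral_iff_enorm, lintegral_prod_symm _ hD.enorm.aemeasurable]
  calc ∫⁻ u in Set.Icc (-r) r, ∫⁻ h, ‖D (h, u)‖ₑ ∂Q
      ≤ ∫⁻ _ in Set.Icc (-r) r, B := by
        refine setLIntegral_mono measurable_const fun u hu => ?_
        rw [← eLpNorm_one_eq_lintegral_enorm]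
        have hm : Measurable fun h => D (h, u) := hD.comp measurable_prodMk_right
        exact (eLpNorm_le_eLpNorm_of_exponent_le (by norm_num)
          hm.aestronglyMeasurable).trans (h u hu)
    _ < ∞ := by
        rw [setLIntegral_const]
        exact ENNReal.mul_lt_top hB.lt_top (by simp)

/-- If `D₁` is almost surely an integrable derivative of `D₀` in the second variable, then the same
relation in integrated form holds after centring. -/
theorem centred_integral_eq {Q : Measure E} [IsProbabilityMeasure Q] {D₀ D₁ : E × ℝ → ℝ} {r : ℝ}
    (h₁ : Integrable D₁ (Q.prod (volume.restrict (Set.Icc (-r) r))))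
    (h₀ : ∀ u ∈ Set.Icc (-r) r, Integrable (fun h => D₀ (h, u)) Q)
    (hftc : ∀ᵐ h ∂Q, IntegrableOn (fun u => D₁ (h, u)) (Set.Icc (-r) r) →
      ∀ a ∈ Set.Icc (-r) r, ∀ b ∈ Set.Icc (-r) r,
        ∫ s in a..b, D₁ (h, s) = D₀ (h, b) - D₀ (h, a)) :
    ∀ᵐ h ∂Q, IntegrableOn (fun u => centred Q D₁ (h, u)) (Set.Icc (-r) r) ∧
      ∀ a ∈ Set.Icc (-r) r, ∀ b ∈ Set.Icc (-r) r,
        ∫ s in a..b, centred Q D₁ (h, s) = centred Q D₀ (h, b) - centred Q D₀ (h, a) := by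
  have hmean : IntegrableOn (fun u => ∫ h, D₁ (h, u) ∂Q) (Set.Icc (-r) r) := h₁.integral_prod_right
  -- By Fubini's theorem almost every path of `D₁` is integrable, which is the premise in `hftc`.
  have hae := h₁.prod_right_ae
  have hsub : ∀ a ∈ Set.Icc (-r) r, ∀ b ∈ Set.Icc (-r) r, Set.uIoc a b ⊆ Set.Icc (-r) r :=
    fun a ha b hb => Set.uIoc_subset_uIcc.trans (Set.uIcc_subset_Icc ha hb)
  have hii : ∀ {g : ℝ → ℝ}, IntegrableOn g (Set.Icc (-r) r) → ∀ a ∈ Set.Icc (-r) r,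
      ∀ b ∈ Set.Icc (-r) r, IntervalIntegrable g volume a b := fun hg a ha b hb =>
    intervalIntegrable_iff.2 (hg.mono_set (hsub a ha b hb))
  have hEq : ∀ a ∈ Set.Icc (-r) r, ∀ b ∈ Set.Icc (-r) r,
      ∫ s in a..b, (∫ h, D₁ (h, s) ∂Q) = (∫ h, D₀ (h, b) ∂Q) - ∫ h, D₀ (h, a) ∂Q := by
    intro a ha b hb
    rw [← integral_sub (h₀ b hb) (h₀ a ha)]
    have hsw : ∫ s in a..b, (∫ h, D₁ (h, s) ∂Q) = ∫ h, (∫ s in a..b, D₁ (h, s)) ∂Q := by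
      refine intervalIntegral_integral_swap ?_
      refine (h₁.mono_measure ?_).swap
      exact Measure.prod_mono le_rfl (Measure.restrict_mono (hsub a ha b hb) le_rfl)
    rw [hsw]
    refine integral_congr_ae ?_
    filter_upwards [hae, hftc] with h h1 h2
    exact h2 h1 a ha b hb
  filter_upwards [hae, hftc] with h h1 h2
  refine ⟨h1.sub hmean, fun a ha b hb => ?_⟩
  simp only [centred]
  rw [intervalIntegral.integral_sub (hii h1 a ha b hb) (hii hmean a ha b hb), h2 h1 a ha b hb,
    hEq a ha b hb]
  ring

end Derivatives

/-! ### Supremum bounds, one coordinate at a time -/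

section Chaining

set_option linter.unusedSectionVars false

variable {Ω ι : Type*} [MeasurableSpace Ω] {P : Measure Ω}

/-- The Cauchy–Schwarz inequality against the constant one. -/
lemma sq_setLIntegral_Icc_le {g : ℝ → ℝ≥0∞} (hg : Measurable g) (δ : ℝ) :
    (∫⁻ s in Set.Icc (-δ) δ, g s) ^ 2
      ≤ ENNReal.ofReal (2 * δ) * ∫⁻ s in Set.Icc (-δ) δ, g s ^ 2 := by
  have h := ENNReal.lintegral_mul_le_Lp_mul_Lq (volume.restrict (Set.Icc (-δ) δ))
    Real.HolderConjugate.two_two (f := fun _ => 1) (g := g) aemeasurable_const hg.aemeasurable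
  simp only [Pi.mul_apply, one_mul, one_pow, lintegral_const, Measure.restrict_apply_univ,
    Real.volume_Icc, sub_neg_eq_add, ENNReal.rpow_two] at h
  calc (∫⁻ s in Set.Icc (-δ) δ, g s) ^ 2
      ≤ (ENNReal.ofReal (δ + δ) ^ (1 / 2 : ℝ)
          * (∫⁻ s in Set.Icc (-δ) δ, g s ^ 2) ^ (1 / 2 : ℝ)) ^ 2 := by gcongr
    _ = _ := by
        rw [← ENNReal.mul_rpow_of_nonneg _ _ (by norm_num), ← ENNReal.rpow_natCast,
          ← ENNReal.rpow_mul, two_mul]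
        norm_num

/-- Minkowski's inequality for an integral over `[-δ, δ]`. -/
lemma eLpNorm_setLIntegral_Icc_le [SFinite P] {g : Ω × ℝ → ℝ≥0∞} (hg : Measurable g) {δ : ℝ}
    {B : ℝ≥0∞} (hB : ∀ s ∈ Set.Icc (-δ) δ, eLpNorm (fun ω => g (ω, s)) 2 P ≤ B) :
    eLpNorm (fun ω => ∫⁻ s in Set.Icc (-δ) δ, g (ω, s)) 2 P ≤ ENNReal.ofReal (2 * δ) * B := by
  rw [← ENNReal.pow_le_pow_left_iff two_ne_zero, eLpNorm_two_sq]
  simp only [enorm_eq_self]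
  have hg2 : Measurable fun x => g x ^ 2 := hg.pow_const 2
  calc ∫⁻ ω, (∫⁻ s in Set.Icc (-δ) δ, g (ω, s)) ^ 2 ∂P
      ≤ ∫⁻ ω, ENNReal.ofReal (2 * δ) * (∫⁻ s in Set.Icc (-δ) δ, g (ω, s) ^ 2) ∂P :=
        lintegral_mono fun ω => sq_setLIntegral_Icc_le (hg.comp measurable_prodMk_left) δ
    _ = ENNReal.ofReal (2 * δ) * ∫⁻ s in Set.Icc (-δ) δ, ∫⁻ ω, g (ω, s) ^ 2 ∂P := by
        rw [lintegral_const_mul' _ _ ENNReal.ofReal_ne_top,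
          lintegral_lintegral_swap (f := fun ω s => g (ω, s) ^ 2) hg2.aemeasurable]
    _ ≤ ENNReal.ofReal (2 * δ) * ∫⁻ _ in Set.Icc (-δ) δ, B ^ 2 := by
        refine mul_le_mul_right ?_ _
        refine setLIntegral_mono measurable_const fun s hs => ?_
        have h := hB s hs
        rw [← ENNReal.pow_le_pow_left_iff two_ne_zero, eLpNorm_two_sq] at h
        simpa only [enorm_eq_self] using h
    _ = (ENNReal.ofReal (2 * δ) * B) ^ 2 := by
        rw [setLIntegral_const, Real.volume_Icc, sub_neg_eq_add, ← two_mul]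
        ring

/-- A bound for a weighted sum of functions of linear forms `w i + ∑_{j < k} a i j * t j`, uniform
in `|t j| ≤ δ`: in each coordinate the supremum is bounded by the value at zero plus the integral
of the absolute derivative. -/
noncomputable def supBound (s : Finset ι) (Y : ℕ → ι → Ω × ℝ → ℝ) (a : ι → ℕ → ℝ) (δ : ℝ) :
    ℕ → ℕ → (ι → ℝ) → Ω × (ι → ℝ) → ℝ≥0∞
  | 0, q, c, x => ‖∑ i ∈ s, c i * Y q i (x.1, x.2 i)‖ₑ
  | k + 1, q, c, x => supBound s Y a δ k q c x + ∫⁻ v in Set.Icc (-δ) δ,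
      supBound s Y a δ k (q + 1) (fun i => c i * a i k) (x.1, fun i => x.2 i + v * a i k)

variable {s : Finset ι} {Y : ℕ → ι → Ω × ℝ → ℝ} {a : ι → ℕ → ℝ} {δ : ℝ}

lemma measurable_shift_line (b : ι → ℝ) :
    Measurable fun y : (Ω × (ι → ℝ)) × ℝ => (y.1.1, fun i => y.1.2 i + y.2 * b i) := by
  refine (measurable_fst.comp measurable_fst).prodMk (measurable_pi_lambda _ fun i => ?_)
  exact ((measurable_pi_apply i).comp (measurable_snd.comp measurable_fst)).add
    (measurable_snd.mul_const _)

lemma measurable_supBound (hY : ∀ q i, Measurable (Y q i)) (k q : ℕ) (c : ι → ℝ) :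
    Measurable (supBound s Y a δ k q c) := by
  induction k generalizing q c with
  | zero =>
    refine Measurable.enorm (Finset.measurable_fun_sum s fun i _ => ?_)
    exact ((hY q i).comp (measurable_fst.prodMk
      ((measurable_pi_apply i).comp measurable_snd))).const_mul _
  | succ k ih =>
    exact (ih q c).add
      ((ih (q + 1) _).comp (measurable_shift_line fun i => a i k)).lintegral_prod_right'

/-- The increment of a weighted sum along a line, for a fixed outcome. -/
lemma enorm_sum_increment_le {r : ℝ} {f g : ι → ℝ → ℝ}
    (hg : ∀ i ∈ s, IntegrableOn (g i) (Set.Icc (-r) r))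
    (hfg : ∀ i ∈ s, ∀ x ∈ Set.Icc (-r) r, ∀ y ∈ Set.Icc (-r) r,
      ∫ v in x..y, g i v = f i y - f i x)
    (c w b : ι → ℝ) (hw : ∀ i ∈ s, |w i| + δ * |b i| ≤ r) {t : ℝ} (ht : |t| ≤ δ) :
    ‖∑ i ∈ s, c i * (f i (w i + t * b i) - f i (w i))‖ₑ
      ≤ ∫⁻ v in Set.Icc (-δ) δ, ‖∑ i ∈ s, c i * b i * g i (w i + v * b i)‖ₑ := by
  have hmem : ∀ i ∈ s, ∀ v, |v| ≤ δ → w i + v * b i ∈ Set.Icc (-r) r := by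
    intro i hi v hv
    refine abs_le.1 ?_
    calc |w i + v * b i| ≤ |w i| + |v| * |b i| := by
          rw [← abs_mul]; exact abs_add_le _ _
      _ ≤ |w i| + δ * |b i| := by gcongr
      _ ≤ r := hw i hi
  have hδ : 0 ≤ δ := (abs_nonneg t).trans ht
  have hmem0 : ∀ i ∈ s, w i ∈ Set.Icc (-r) r := fun i hi => by
    simpa using hmem i hi 0 (by simpa using hδ)
  have hint : ∀ i ∈ s, IntervalIntegrable (fun v => g i (w i + v * b i)) volume 0 t := by
    intro i hi
    -- The change of variables below divides by `b i`; otherwise the integrand is constant.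
    by_cases hb : b i = 0
    · simp [hb]
    have h1 : IntervalIntegrable (g i) volume (w i) (w i + t * b i) :=
      intervalIntegrable_iff.2 ((hg i hi).mono_set (Set.uIoc_subset_uIcc.trans
        (Set.uIcc_subset_Icc (hmem0 i hi) (hmem i hi t ht))))
    have h2 := (h1.comp_add_left (w i)).comp_mul_right (c := b i)
    simp only [sub_self, add_sub_cancel_left, zero_div, mul_div_assoc, div_self hb, mul_one] at h2
    exact h2
  have hEq : ∀ i ∈ s, c i * (f i (w i + t * b i) - f i (w i))
      = ∫ v in (0 : ℝ)..t, c i * b i * g i (w i + v * b i) := by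
    intro i hi
    have h := intervalIntegral.smul_integral_comp_add_mul (a := 0) (b := t) (g i) (b i) (w i)
    rw [smul_eq_mul, mul_zero, add_zero, mul_comm (b i) t,
      hfg i hi _ (hmem0 i hi) _ (hmem i hi t ht)] at h
    rw [intervalIntegral.integral_const_mul, ← h]
    simp_rw [mul_comm (b i) _]
    ring
  rw [Finset.sum_congr rfl hEq, ← intervalIntegral.integral_finsetSum
    fun i hi => (hint i hi).const_mul _]
  rw [← ofReal_norm,
    intervalIntegral.norm_integral_eq_norm_integral_uIoc, ofReal_norm]
  refine (enorm_integral_le_lintegral_enorm _).trans (lintegral_mono_set ?_)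
  refine Set.uIoc_subset_uIcc.trans (Set.uIcc_subset_Icc ?_ (abs_le.1 ht))
  constructor <;> linarith

/-- Induction on the number of coordinates: switching on the last one adds an integral of a sum of
order `q + 1`, to which the claim applies from a shifted base point. The budget `hw` keeps every
argument in `[-r, r]`. -/
lemma enorm_sum_le_supBound {r : ℝ} {p : ℕ} {ω : Ω}
    (hg : ∀ q < p, ∀ i ∈ s, IntegrableOn (fun u => Y (q + 1) i (ω, u)) (Set.Icc (-r) r))
    (hfg : ∀ q < p, ∀ i ∈ s, ∀ x ∈ Set.Icc (-r) r, ∀ y ∈ Set.Icc (-r) r,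
      ∫ v in x..y, Y (q + 1) i (ω, v) = Y q i (ω, y) - Y q i (ω, x))
    {t : ℕ → ℝ} (ht : ∀ j, |t j| ≤ δ) (k q : ℕ) (hk : q + k ≤ p) (c w : ι → ℝ)
    (hw : ∀ i ∈ s, |w i| + δ * ∑ j ∈ Finset.range k, |a i j| ≤ r) :
    ‖∑ i ∈ s, c i * Y q i (ω, w i + ∑ j ∈ Finset.range k, t j * a i j)‖ₑ
      ≤ supBound s Y a δ k q c (ω, w) := by
  have hδ : 0 ≤ δ := (abs_nonneg _).trans (ht 0)
  induction k generalizing q c w with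
  | zero => simp [supBound]
  | succ k ih =>
    have hw' : ∀ i ∈ s, |w i| + δ * |a i k| + δ * ∑ j ∈ Finset.range k, |a i j| ≤ r := by
      intro i hi
      have h := hw i hi
      rw [Finset.sum_range_succ] at h
      linarith
    set w' : ι → ℝ := fun i => w i + ∑ j ∈ Finset.range k, t j * a i j with hw'def
    have habs : ∀ i, |w' i| ≤ |w i| + δ * ∑ j ∈ Finset.range k, |a i j| := by
      intro i
      refine (abs_add_le _ _).trans ?_
      gcongr
      refine (Finset.abs_sum_le_sum_abs _ _).trans ?_
      rw [Finset.mul_sum]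
      refine Finset.sum_le_sum fun j _ => ?_
      rw [abs_mul]
      gcongr
      exact ht j
    have hsplit : ∑ i ∈ s, c i * Y q i (ω, w i + ∑ j ∈ Finset.range (k + 1), t j * a i j)
        = ∑ i ∈ s, c i * Y q i (ω, w' i)
          + ∑ i ∈ s, c i * (Y q i (ω, w' i + t k * a i k) - Y q i (ω, w' i)) := by
      rw [← Finset.sum_add_distrib]
      refine Finset.sum_congr rfl fun i _ => ?_
      rw [Finset.sum_range_succ, ← add_assoc]
      ring
    rw [hsplit]
    refine (enorm_add_le _ _).trans (add_le_add ?_ ?_)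
    · refine ih q (by omega) c w fun i hi => ?_
      have h := hw' i hi
      have : 0 ≤ δ * |a i k| := by positivity
      linarith
    · refine (enorm_sum_increment_le (f := fun i u => Y q i (ω, u))
        (g := fun i u => Y (q + 1) i (ω, u)) (hg q (by omega)) (hfg q (by omega)) c w'
        (fun i => a i k) (fun i hi => ?_) (ht k)).trans ?_
      · have h := hw' i hi
        have h' := habs i
        linarith
      · refine setLIntegral_mono' measurableSet_Icc fun v hv => ?_
        have h := ih (q + 1) (by omega) (fun i => c i * a i k) (fun i => w i + v * a i k) ?_
        · refine le_trans (le_of_eq ?_) h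
          congr 1
          refine Finset.sum_congr rfl fun i _ => ?_
          simp only [hw'def]
          congr 3
          ring
        · intro i hi
          have h1 : |w i + v * a i k| ≤ |w i| + δ * |a i k| := by
            refine (abs_add_le _ _).trans ?_
            rw [abs_mul]
            gcongr
            exact abs_le.2 hv
          have h := hw' i hi
          linarith

lemma sqrt_sum_mul_sq_le (c b : ι → ℝ) {ρ : ℝ} (hρ : 0 ≤ ρ) (hb : ∀ i ∈ s, |b i| ≤ ρ) :
    √(∑ i ∈ s, (c i * b i) ^ 2) ≤ ρ * √(∑ i ∈ s, c i ^ 2) := by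
  rw [← Real.sqrt_sq hρ, ← Real.sqrt_mul (sq_nonneg ρ)]
  apply Real.sqrt_le_sqrt
  rw [Finset.mul_sum]
  refine Finset.sum_le_sum fun i hi => ?_
  rw [mul_pow, mul_comm]
  gcongr ?_ * _
  rw [← sq_abs]
  gcongr
  exact hb i hi

/-- Each coordinate multiplies the bound by `1 + 2δρ`: one for the value at zero, `2δ` for the
length of the interval, `ρ` for the additional weight `a i k`. -/
lemma eLpNorm_supBound_le [SFinite P] (hY : ∀ q i, Measurable (Y q i)) {r ρ : ℝ} {p : ℕ}
    {K : ℝ≥0∞} (hδ : 0 ≤ δ) (hρ : 0 ≤ ρ)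
    (hK : ∀ q, 1 ≤ q → q ≤ p → ∀ c w : ι → ℝ, (∀ i ∈ s, |w i| ≤ r) →
      eLpNorm (fun ω => ∑ i ∈ s, c i * Y q i (ω, w i)) 2 P
        ≤ ENNReal.ofReal √(∑ i ∈ s, c i ^ 2) * K)
    (k q : ℕ) (ha : ∀ i ∈ s, ∀ j < k, |a i j| ≤ ρ) (hq : 1 ≤ q) (hk : q + k ≤ p) (c w : ι → ℝ)
    (hw : ∀ i ∈ s, |w i| + δ * ∑ j ∈ Finset.range k, |a i j| ≤ r) :
    eLpNorm (fun ω => supBound s Y a δ k q c (ω, w)) 2 P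
      ≤ ENNReal.ofReal (√(∑ i ∈ s, c i ^ 2) * (1 + 2 * δ * ρ) ^ k) * K := by
  induction k generalizing q c w with
  | zero =>
    simp only [supBound, pow_zero, mul_one]
    rw [eLpNorm_enorm]
    exact hK q hq (by omega) c w fun i hi => by simpa using hw i hi
  | succ k ih =>
    have hw' : ∀ i ∈ s, |w i| + δ * |a i k| + δ * ∑ j ∈ Finset.range k, |a i j| ≤ r := by
      intro i hi
      have h := hw i hi
      rw [Finset.sum_range_succ] at h
      linarith
    have ha' : ∀ i ∈ s, ∀ j < k, |a i j| ≤ ρ := fun i hi j hj => ha i hi j (by omega)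
    set A : ℝ := √(∑ i ∈ s, c i ^ 2) with hA
    have hpow : (0 : ℝ) ≤ (1 + 2 * δ * ρ) ^ k := by positivity
    have hm1 : Measurable fun ω => supBound s Y a δ k q c (ω, w) :=
      (measurable_supBound hY k q c).comp measurable_prodMk_right
    have hm2 : Measurable fun x : Ω × ℝ => supBound s Y a δ k (q + 1) (fun i => c i * a i k)
        (x.1, fun i => w i + x.2 * a i k) := by
      have hx : Measurable fun x : Ω × ℝ => ((x.1, w), x.2) :=
        (measurable_fst.prodMk measurable_const).prodMk measurable_snd
      exact (measurable_supBound hY k (q + 1) fun i => c i * a i k).comp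
        ((measurable_shift_line fun i => a i k).comp hx)
    have h1 := ih q ha' hq (by omega) c w fun i hi => by
      have h := hw' i hi
      have : 0 ≤ δ * |a i k| := by positivity
      linarith
    have h2 := eLpNorm_setLIntegral_Icc_le (P := P) hm2 (δ := δ)
      (B := ENNReal.ofReal (ρ * A * (1 + 2 * δ * ρ) ^ k) * K) (fun v hv => by
        refine (ih (q + 1) ha' (by omega) (by omega) (fun i => c i * a i k)
          (fun i => w i + v * a i k) fun i hi => ?_).trans ?_
        · have h1 : |w i + v * a i k| ≤ |w i| + δ * |a i k| := by
            refine (abs_add_le _ _).trans ?_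
            rw [abs_mul]
            gcongr
            exact abs_le.2 hv
          have h := hw' i hi
          linarith
        · gcongr
          exact sqrt_sum_mul_sq_le c _ hρ fun i hi => ha i hi k (by omega))
    simp only [supBound]
    refine (eLpNorm_add_le hm1.aestronglyMeasurable
      (hm2.lintegral_prod_right').aestronglyMeasurable (by norm_num)).trans ?_
    refine (add_le_add h1 h2).trans (le_of_eq ?_)
    rw [← mul_assoc, ← ENNReal.ofReal_mul (by positivity), ← add_mul,
      ← ENNReal.ofReal_add (by positivity) (by positivity)]
    congr 2
    ring

/-- A measurable majorant, with a mean square bound, for the increments of a weighted sum of functions of linear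
forms. -/
theorem exists_majorant_increment [SFinite P] (hY : ∀ q i, Measurable (Y q i)) {r ρ V : ℝ} {p : ℕ}
    {K : ℝ≥0∞} (hδ : 0 ≤ δ) (hρ : 0 ≤ ρ)
    (hK : ∀ q, 1 ≤ q → q ≤ p → ∀ c w : ι → ℝ, (∀ i ∈ s, |w i| ≤ r) →
      eLpNorm (fun ω => ∑ i ∈ s, c i * Y q i (ω, w i)) 2 P
        ≤ ENNReal.ofReal √(∑ i ∈ s, c i ^ 2) * K)
    (hae : ∀ᵐ ω ∂P, ∀ q < p, ∀ i ∈ s, IntegrableOn (fun u => Y (q + 1) i (ω, u)) (Set.Icc (-r) r) ∧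
      ∀ x ∈ Set.Icc (-r) r, ∀ y ∈ Set.Icc (-r) r,
        ∫ v in x..y, Y (q + 1) i (ω, v) = Y q i (ω, y) - Y q i (ω, x))
    (ha : ∀ i ∈ s, ∀ j < p, |a i j| ≤ ρ) (har : δ * (p * ρ) ≤ r) (c : ι → ℝ)
    (hV : ∀ j < p, √(∑ i ∈ s, (c i * a i j) ^ 2) ≤ V) :
    ∃ W : Ω → ℝ≥0∞, Measurable W ∧
      (∀ᵐ ω ∂P, ∀ t : ℕ → ℝ, (∀ j, |t j| ≤ δ) → ‖∑ i ∈ s, c i *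
        (Y 0 i (ω, ∑ j ∈ Finset.range p, t j * a i j) - Y 0 i (ω, 0))‖ₑ ≤ W ω) ∧
      eLpNorm W 2 P ≤ ENNReal.ofReal (p * (2 * δ * V * (1 + 2 * δ * ρ) ^ p)) * K := by
  -- `Z k` majorises the change when coordinate `k` is switched on after those below it; `supBound`
  -- handles the supremum over the latter.
  set Z : ℕ → Ω → ℝ≥0∞ := fun k ω => ∫⁻ v in Set.Icc (-δ) δ,
    supBound s Y a δ k 1 (fun i => c i * a i k) (ω, fun i => 0 + v * a i k) with hZ
  have hsum : ∀ i ∈ s, ∀ k ≤ p, δ * ∑ j ∈ Finset.range k, |a i j| ≤ r := by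
    intro i hi k hk
    refine le_trans ?_ har
    gcongr
    calc ∑ j ∈ Finset.range k, |a i j| ≤ ∑ _j ∈ Finset.range k, ρ :=
          Finset.sum_le_sum fun j hj => ha i hi j (by have := Finset.mem_range.1 hj; omega)
      _ = k * ρ := by simp
      _ ≤ p * ρ := by gcongr
  have hline : ∀ i ∈ s, ∀ k < p, ∀ v, |v| ≤ δ →
      |0 + v * a i k| + δ * ∑ j ∈ Finset.range k, |a i j| ≤ r := by
    intro i hi k hk v hv
    have h := hsum i hi (k + 1) hk
    rw [Finset.sum_range_succ] at h
    rw [zero_add, abs_mul]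
    have : |v| * |a i k| ≤ δ * |a i k| := by gcongr
    linarith
  have hmZ : ∀ k, Measurable fun x : Ω × ℝ => supBound s Y a δ k 1 (fun i => c i * a i k)
      (x.1, fun i => 0 + x.2 * a i k) := by
    intro k
    have hx : Measurable fun x : Ω × ℝ => ((x.1, fun _ : ι => (0 : ℝ)), x.2) :=
      (measurable_fst.prodMk measurable_const).prodMk measurable_snd
    exact (measurable_supBound hY k 1 fun i => c i * a i k).comp
      ((measurable_shift_line fun i => a i k).comp hx)
  refine ⟨fun ω => ∑ k ∈ Finset.range p, Z k ω,
    Finset.measurable_fun_sum _ fun k _ => (hmZ k).lintegral_prod_right', ?_, ?_⟩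
  · filter_upwards [hae] with ω hω t ht
    suffices H : ∀ k ≤ p, ‖∑ i ∈ s, c i *
        (Y 0 i (ω, ∑ j ∈ Finset.range k, t j * a i j) - Y 0 i (ω, 0))‖ₑ
        ≤ ∑ k ∈ Finset.range k, Z k ω from H p le_rfl
    intro k
    induction k with
    | zero => simp
    | succ k ih =>
      intro hk
      have hsplit : ∑ i ∈ s, c i *
          (Y 0 i (ω, ∑ j ∈ Finset.range (k + 1), t j * a i j) - Y 0 i (ω, 0))
          = ∑ i ∈ s, c i * (Y 0 i (ω, ∑ j ∈ Finset.range k, t j * a i j) - Y 0 i (ω, 0))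
            + ∑ i ∈ s, c i * (Y 0 i (ω, ∑ j ∈ Finset.range k, t j * a i j + t k * a i k)
              - Y 0 i (ω, ∑ j ∈ Finset.range k, t j * a i j)) := by
        rw [← Finset.sum_add_distrib]
        refine Finset.sum_congr rfl fun i _ => ?_
        rw [Finset.sum_range_succ]
        ring
      rw [hsplit, Finset.sum_range_succ]
      refine (enorm_add_le _ _).trans (add_le_add (ih (by omega)) ?_)
      refine (enorm_sum_increment_le (f := fun i u => Y 0 i (ω, u))
        (g := fun i u => Y (0 + 1) i (ω, u)) (fun i hi => (hω 0 (by omega) i hi).1)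
        (fun i hi => (hω 0 (by omega) i hi).2) c
        (fun i => ∑ j ∈ Finset.range k, t j * a i j)
        (fun i => a i k) (fun i hi => ?_) (ht k)).trans ?_
      · have h := hsum i hi (k + 1) hk
        rw [Finset.sum_range_succ] at h
        have h' : |∑ j ∈ Finset.range k, t j * a i j| ≤ δ * ∑ j ∈ Finset.range k, |a i j| := by
          refine (Finset.abs_sum_le_sum_abs _ _).trans ?_
          rw [Finset.mul_sum]
          refine Finset.sum_le_sum fun j _ => ?_
          rw [abs_mul]
          gcongr
          exact ht j
        linarith
      · refine setLIntegral_mono' measurableSet_Icc fun v hv => ?_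
        -- The bound starts at order one and reaches order `1 + k`, which is at most `p` because `k
        -- < p`.
        have h := enorm_sum_le_supBound (Y := Y) (a := a) (s := s) (δ := δ) (r := r) (p := p)
          (ω := ω) (fun q hq i hi => (hω q hq i hi).1) (fun q hq i hi => (hω q hq i hi).2) ht k 1
          (by omega) (fun i => c i * a i k) (fun i => 0 + v * a i k)
          (fun i hi => hline i hi k (by omega) v (abs_le.2 hv))
        refine le_trans (le_of_eq ?_) h
        congr 1
        refine Finset.sum_congr rfl fun i _ => ?_
        congr 3
        ring
  · have hZn : ∀ k < p, eLpNorm (Z k) 2 P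
        ≤ ENNReal.ofReal (2 * δ * V * (1 + 2 * δ * ρ) ^ p) * K := by
      intro k hk
      have hV0 : 0 ≤ V := (Real.sqrt_nonneg _).trans (hV k hk)
      refine (eLpNorm_setLIntegral_Icc_le (P := P) (hmZ k) (δ := δ)
        (B := ENNReal.ofReal (V * (1 + 2 * δ * ρ) ^ p) * K) fun v hv => ?_).trans (le_of_eq ?_)
      · refine (eLpNorm_supBound_le hY hδ hρ hK k 1 (fun i hi j hj => ha i hi j (by omega)) le_rfl
          (by omega) _ _ (fun i hi => hline i hi k hk v (abs_le.2 hv))).trans ?_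
        gcongr
        · exact hV k hk
        · have : 0 ≤ 2 * δ * ρ := by positivity
          linarith
      · rw [← mul_assoc, ← ENNReal.ofReal_mul (by positivity)]
        congr 2
        ring
    calc eLpNorm (fun ω => ∑ k ∈ Finset.range p, Z k ω) 2 P
        = eLpNorm (∑ k ∈ Finset.range p, Z k) 2 P := by
          congr 1; ext ω; simp
      _ ≤ ∑ k ∈ Finset.range p, eLpNorm (Z k) 2 P :=
          eLpNorm_sum_le (fun k _ => ((hmZ k).lintegral_prod_right').aestronglyMeasurable)
            (by norm_num)
      _ ≤ ∑ _k ∈ Finset.range p, ENNReal.ofReal (2 * δ * V * (1 + 2 * δ * ρ) ^ p) * K :=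
          Finset.sum_le_sum fun k hk => hZn k (Finset.mem_range.1 hk)
      _ = _ := by
          rw [Finset.sum_const, Finset.card_range, nsmul_eq_mul, ← mul_assoc,
            ENNReal.ofReal_mul (Nat.cast_nonneg p), ENNReal.ofReal_natCast]

end Chaining

/-! ### Conditional tails and the bound at a fixed sample size -/

section Remainder

variable {Ω S : Type*} [MeasurableSpace Ω] [MeasurableSpace S] {P : Measure Ω}
  [IsProbabilityMeasure P]

lemma condKernel_congr {E F : Type*} [MeasurableSpace E] [MeasurableSpace F]
    [StandardBorelSpace F] [Nonempty F] {μ ν : Measure (E × F)} [IsFiniteMeasure μ]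
    [IsFiniteMeasure ν] (h : μ = ν) : μ.condKernel = ν.condKernel := by
  subst h; rfl

/-- At every time the input and the next output are jointly the image of `Q` under one map, and
`condDistrib` depends on this joint law only. The kernels are therefore equal, not merely almost
everywhere. -/
lemma condLaw_eq {ε : ℤ → Ω → S} (hε : ∀ k, Measurable (ε k)) {Q : Measure (ℕ → S)}
    (hQ : ∀ i, P.map (past ε i) = Q) {g : (ℕ → S) → ℝ} (hg : Measurable g) (i : ℤ) :
    condLaw P g ε i = condLaw P g ε 0 := by
  have key : ∀ i : ℤ, P.map (fun ω => (past ε i ω, output g ε (i + 1) ω))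
      = Q.map fun h => (drop 1 h, g h) := by
    intro i
    rw [← hQ (i + 1), Measure.map_map ((measurable_drop 1).prodMk hg) (measurable_past hε _)]
    congr 1
    ext1 ω
    have hd := congrFun (drop_comp_past ε (i + 1) 1) ω
    simp only [Function.comp_apply, Nat.cast_one, add_sub_cancel_right] at hd
    simp only [Function.comp_apply, hd, output]
  unfold condLaw
  rw [condDistrib, condDistrib]
  exact condKernel_congr ((key i).trans (key 0).symm)

instance isMarkovKernel_condLaw (g : (ℕ → S) → ℝ) (ε : ℤ → Ω → S) (i : ℤ) : IsMarkovKernel (condLaw P g ε i) := by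
  unfold condLaw; infer_instance

lemma measurable_iota (g : (ℕ → S) → ℝ) (ε : ℤ → Ω → S) (i : ℤ) :
    Measurable fun x : (ℕ → S) × ℝ => iota P g ε i x.1 x.2 := by
  have hs : MeasurableSet {y : ((ℕ → S) × ℝ) × ℝ | y.1.2 < y.2} :=
    measurableSet_lt (measurable_snd.comp measurable_fst) measurable_snd
  exact (Kernel.measurable_kernel_prodMk_left
    (κ := (condLaw P g ε i).comap Prod.fst measurable_fst) hs).ennreal_toReal

lemma iota_mem_Icc (g : (ℕ → S) → ℝ) (ε : ℤ → Ω → S) (i : ℤ) (h : ℕ → S) (u : ℝ) :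
    iota P g ε i h u ∈ Set.Icc (0 : ℝ) 1 :=
  ⟨measureReal_nonneg, measureReal_le_one⟩

/-- For `c > 0` the integrand is `-a` plus the indicator of `y > b / c`; the constant cancels on
centring. -/
lemma integral_psi {κ : Measure ℝ} [IsProbabilityMeasure κ] (a b : ℝ) {c : ℝ} (hc : 0 < c) :
    ∫ y, psi a (c * y - b) ∂κ = -a + κ.real (Set.Ioi (b / c)) := by
  have h : ∀ y, psi a (c * y - b) = -a + Set.indicator (Set.Ioi (b / c)) (fun _ => (1 : ℝ)) y := by
    intro y
    unfold psi
    by_cases hy : b / c < y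
    · have h1 : ¬ (c * y - b ≤ 0) := by
        rw [div_lt_iff₀ hc] at hy; linarith
      rw [Set.indicator_of_notMem (by simpa using h1), Set.indicator_of_mem (by simpa using hy)]
      ring
    · have h1 : c * y - b ≤ 0 := by
        rw [not_lt, le_div_iff₀ hc] at hy; linarith
      rw [Set.indicator_of_mem (by simpa using h1), Set.indicator_of_notMem (by simpa using hy)]
      ring
  simp_rw [h]
  rw [integral_add (integrable_const _) ((integrable_const _).indicator measurableSet_Ioi),
    integral_indicator_const _ measurableSet_Ioi]
  simp

lemma measureReal_output_Ioi {ε : ℤ → Ω → S} (hε : ∀ k, Measurable (ε k)) {g : (ℕ → S) → ℝ}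
    (hg : Measurable g) (i : ℤ) (u : ℝ) :
    (P.map (output g ε (i + 1))).real (Set.Ioi u) = ∫ ω, iota P g ε i (past ε i ω) u ∂P := by
  have hout : Measurable (output g ε (i + 1)) := hg.comp (measurable_past hε _)
  have h := setLIntegral_preimage_condDistrib (μ := P) (measurable_past hε i)
    hout.aemeasurable (measurableSet_Ioi (a := u)) MeasurableSet.univ
  simp only [Set.preimage_univ, Measure.restrict_univ, Set.univ_inter] at h
  rw [measureReal_def, Measure.map_apply hout measurableSet_Ioi, ← h]
  unfold iota condLaw
  simp only [measureReal_def]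
  rw [integral_toReal]
  · exact ((Kernel.measurable_coe _ measurableSet_Ioi).comp (measurable_past hε i)).aemeasurable
  · exact ae_of_all _ fun ω => measure_lt_top _ _

/-- The remainder in terms of the centred conditional tail probabilities. -/
lemma remainder_eq {p : ℕ} {ε : ℤ → Ω → S} (hε : ∀ k, Measurable (ε k)) {g : (ℕ → S) → ℝ}
    (hg : Measurable g) (a : ℝ) {n : ℕ} {γ : ℕ → ℝ} (hγ : ∀ i ∈ Finset.Icc 1 n, 0 < γ i)
    (z : ℕ → EuclideanSpace ℝ (Fin p)) (φ : EuclideanSpace ℝ (Fin p)) (ω : Ω) :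
    remainder P g ε a n γ z φ ω = ∑ i ∈ Finset.Icc 1 n,
      (centred P (fun x => iota P g ε ((i : ℤ) - 1) (past ε ((i : ℤ) - 1) x.1) x.2)
        (ω, inner ℝ (z i) φ / γ i)) • z i := by
  refine Finset.sum_congr rfl fun i hi => ?_
  congr 1
  have hout : Measurable (output g ε i) := hg.comp (measurable_past hε _)
  have hprob : IsProbabilityMeasure (P.map (output g ε i)) :=
    Measure.isProbabilityMeasure_map hout.aemeasurable
  have h1 : ∫ ω', psi a (γ i * output g ε i ω' - inner ℝ (z i) φ) ∂P
      = ∫ y, psi a (γ i * y - inner ℝ (z i) φ) ∂(P.map (output g ε i)) := by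
    refine (integral_map (f := fun y => psi a (γ i * y - inner ℝ (z i) φ))
      hout.aemeasurable ?_).symm
    refine Measurable.aestronglyMeasurable ?_
    have hpsi : Measurable (psi a) :=
      measurable_const.sub (measurable_const.indicator measurableSet_Iic)
    exact hpsi.comp ((measurable_id.const_mul _).sub_const _)
  have h2 := measureReal_output_Ioi (P := P) hε hg ((i : ℤ) - 1) (inner ℝ (z i) φ / γ i)
  rw [sub_add_cancel] at h2
  rw [h1, integral_psi _ _ (hγ i hi), integral_psi _ _ (hγ i hi), h2]
  simp only [centred, iota]
  ring

lemma enorm_le_sum_enorm {p : ℕ} (v : EuclideanSpace ℝ (Fin p)) : ‖v‖ₑ ≤ ∑ l, ‖v l‖ₑ := by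
  have h : ‖v‖ ≤ ∑ l, ‖v l‖ := by
    rw [EuclideanSpace.norm_eq]
    refine Real.sqrt_le_iff.2 ⟨Finset.sum_nonneg fun l _ => norm_nonneg _, ?_⟩
    exact Finset.sum_sq_le_sq_sum_of_nonneg fun l _ => norm_nonneg _
  rw [← ofReal_norm]
  refine (ENNReal.ofReal_le_ofReal h).trans (le_of_eq ?_)
  rw [ENNReal.ofReal_sum_of_nonneg fun l _ => norm_nonneg _]
  simp only [ofReal_norm]

/-- The coordinate `j` of a vector, and zero for `j ≥ p`. -/
noncomputable def coord {p : ℕ} (v : EuclideanSpace ℝ (Fin p)) (j : ℕ) : ℝ :=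
  if h : j < p then v ⟨j, h⟩ else 0

lemma abs_coord_le {p : ℕ} (v : EuclideanSpace ℝ (Fin p)) (j : ℕ) : |coord v j| ≤ ‖v‖ := by
  unfold coord
  split_ifs with h
  · exact PiLp.norm_apply_le v ⟨j, h⟩
  · simp

lemma inner_div_eq_sum_coord {p : ℕ} (v φ : EuclideanSpace ℝ (Fin p)) (c : ℝ) :
    inner ℝ v φ / c = ∑ j ∈ Finset.range p, coord φ j * (coord v j / c) := by
  rw [Finset.sum_range, PiLp.inner_apply, Finset.sum_div]
  refine Finset.sum_congr rfl fun j _ => ?_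
  simp only [coord, j.2, dif_pos, Fin.eta]
  simp [mul_div_assoc]

section Tail

variable {ε : ℤ → Ω → S} {g : (ℕ → S) → ℝ} {p : ℕ} {r : ℝ}

/-- The measurable version of `ι^{(q)}`. -/
noncomputable def iotaVersion (P : Measure Ω) [IsFiniteMeasure P] (g : (ℕ → S) → ℝ)
    (ε : ℤ → Ω → S) (q : ℕ) : (ℕ → S) × ℝ → ℝ :=
  measDeriv (fun x => iota P g ε 0 x.1 x.2) q

lemma measurable_iotaVersion (q : ℕ) : Measurable (iotaVersion P g ε q) :=
  measurable_measDeriv (measurable_iota g ε 0) q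

/-- Derivatives of `iota` exist only on almost every path and near zero, so Fubini's theorem needs a
jointly measurable substitute. One built from the kernel at time zero serves all times. -/
lemma iotaVersion_ae_eq (hr : 0 < r) {i : ℤ}
    (hlaw : condLaw P g ε i = condLaw P g ε 0)
    (hdiff : ∀ᵐ ω ∂P, ∀ q < p, ∀ u ∈ Set.Icc (-r) r,
      DifferentiableAt ℝ (iotaDeriv P g ε i q (past ε i ω)) u) :
    ∀ᵐ ω ∂P, ∀ q ≤ p, ∀ u ∈ Set.Icc (-r) r,
      iotaVersion P g ε q (past ε i ω, u) = iotaDeriv P g ε i q (past ε i ω) u := by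
  have hiota : iota P g ε i = iota P g ε 0 := by
    ext h u; simp only [iota, hlaw]
  filter_upwards [hdiff] with ω hω q hq u hu
  have h := measDeriv_eq_iteratedDeriv (F := fun x : (ℕ → S) × ℝ => iota P g ε 0 x.1 x.2)
    (h := past ε i ω) hr (p := p) (fun q hq u hu => by
      have := hω q hq u hu
      unfold iotaDeriv at this
      rw [hiota] at this
      exact this) q hq u hu
  unfold iotaDeriv
  rw [hiota]
  exact h

end Tail

variable {ε : ℤ → Ω → S} {ε' : Ω → S} {g : (ℕ → S) → ℝ} {p : ℕ} {r : ℝ}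

lemma memLp_iotaVersion (hε : ∀ k, Measurable (ε k)) {Q : Measure (ℕ → S)}
    (hQ : ∀ i, P.map (past ε i) = Q)
    (hEq : ∀ i : ℕ, ∀ᵐ ω ∂P, ∀ q ≤ p, ∀ u ∈ Set.Icc (-r) r,
      iotaVersion P g ε q (past ε i ω, u) = iotaDeriv P g ε i q (past ε i ω) u)
    {q : ℕ} (hq : q ≤ p)
    (hbdd : (⨆ u ∈ Set.Icc (-r) r,
      eLpNorm (fun ω => iotaDeriv P g ε (0 : ℕ) q (past ε (0 : ℕ) ω) u) 2 P) < ∞)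
    {u : ℝ} (hu : u ∈ Set.Icc (-r) r) :
    MemLp (fun h => iotaVersion P g ε q (h, u)) 2 Q := by
  have hm : Measurable fun h => iotaVersion P g ε q (h, u) :=
    (measurable_iotaVersion q).comp measurable_prodMk_right
  refine ⟨hm.aestronglyMeasurable, ?_⟩
  rw [← hQ (0 : ℕ), eLpNorm_map_measure hm.aestronglyMeasurable
    (measurable_past hε _).aemeasurable]
  refine lt_of_le_of_lt ?_ hbdd
  refine le_trans (le_of_eq (eLpNorm_congr_ae ?_)) (le_iSup₂ (f := fun u (_ : u ∈ Set.Icc (-r) r) =>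
    eLpNorm (fun ω => iotaDeriv P g ε (0 : ℕ) q (past ε (0 : ℕ) ω) u) 2 P) u hu)
  filter_upwards [hEq 0] with ω hω
  exact hω q hq u hu

/-- Mean square bound for weighted sums of centred derivatives. -/
theorem eLpNorm_sum_centred_le (hε : ∀ k, Measurable (ε k)) (hε' : Measurable ε')
    (hindep : iIndepFun ε P) (hindep' : IndepFun ε' (fun ω k => ε k ω) P)
    {Q : Measure (ℕ → S)} (hQ : ∀ i, P.map (past ε i) = Q)
    (hEq : ∀ i : ℕ, ∀ᵐ ω ∂P, ∀ q ≤ p, ∀ u ∈ Set.Icc (-r) r,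
      iotaVersion P g ε q (past ε i ω, u) = iotaDeriv P g ε i q (past ε i ω) u)
    {q : ℕ} (hq : q ≤ p)
    (hmem : ∀ u ∈ Set.Icc (-r) r, MemLp (fun h => iotaVersion P g ε q (h, u)) 2 Q)
    (s : Finset ℕ) (c w : ℕ → ℝ) (hw : ∀ i ∈ s, |w i| ≤ r) :
    eLpNorm (fun ω => ∑ i ∈ s, c i * centred P
        (fun x => iotaVersion P g ε q (past ε ((i : ℤ) - 1) x.1, x.2)) (ω, w i)) 2 P
      ≤ ENNReal.ofReal √(∑ i ∈ s, c i ^ 2) * ∑' m : ℕ, ⨆ u ∈ Set.Icc (-r) r,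
        eLpNorm (predictiveGap P g ε ε' q m u) 2 P := by
  set f : ℕ → (ℕ → S) → ℝ := fun i h => iotaVersion P g ε q (h, w i) with hf
  have hfm : ∀ i, Measurable (f i) := fun i =>
    (measurable_iotaVersion q).comp measurable_prodMk_right
  have hprobQ : IsProbabilityMeasure Q := by
    rw [← hQ 0]; exact Measure.isProbabilityMeasure_map (measurable_past hε 0).aemeasurable
  have hfL : ∀ i ∈ s, MemLp (f i) 2 Q := fun i hi => hmem _ (abs_le.1 (hw i hi))
  have hcomp : ∀ i ∈ s, ∀ k, MemLp (f i ∘ past ε k) 2 P := fun i hi k =>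
    MemLp.comp_of_map (by rw [hQ k]; exact hfL i hi) (measurable_past hε k).aemeasurable
  have hadapt : ∀ i k, StronglyMeasurable[pastSigma ε k] (f i ∘ past ε k) := fun i k =>
    ((hfm i).comp (comap_measurable (past ε k))).stronglyMeasurable
  refine eLpNorm_sum_sub_integral_le (pastSigma_mono ε) (pastSigma_le hε) s
    (fun i : ℕ => (i : ℤ) - 1) (fun i j h => by simpa using h) c
    (X := fun i => f i ∘ past ε ((i : ℤ) - 1)) (fun i hi => hcomp i hi _)
    (fun i _ => hadapt i _)
    (fun i hi => tendsto_condExp_remote_past hε hindep _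
      ((hcomp i hi _).integrable (by norm_num)) (hadapt i _)) ?_
  intro i hi m
  rw [eLpNorm_proj_shift hε hQ ((hfL i hi).integrable (by norm_num))]
  -- Only the measurability of the coupled conditional expectation matters, so `iotaDeriv` can stay
  -- there. The supremum over `u` then lets the points `w i` vary with `i`.
  refine (eLpNorm_proj_le_coupled hε hε' hindep' (hcomp i hi m)
    (B := P[fun ω => iotaDeriv P g ε m q (past (coupled ε ε') m ω) (w i) |
      pastSigma (coupled ε ε') 0]) stronglyMeasurable_condExp).trans ?_
  refine le_trans (le_of_eq (eLpNorm_congr_ae ?_))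
    (le_iSup₂ (f := fun u (_ : u ∈ Set.Icc (-r) r) =>
      eLpNorm (predictiveGap P g ε ε' q m u) 2 P) (w i) (abs_le.1 (hw i hi)))
  refine EventuallyEq.sub (condExp_congr_ae ?_) (ae_eq_refl _)
  filter_upwards [hEq m] with ω hω
  exact hω q hq (w i) (abs_le.1 (hw i hi))

/-- The centred derivatives are primitives of each other. -/
theorem ae_centred_integral_eq (hε : ∀ k, Measurable (ε k)) {Q : Measure (ℕ → S)}
    (hQ : ∀ i, P.map (past ε i) = Q)
    {i : ℕ} (hdiff : ∀ᵐ ω ∂P, ∀ q < p, ∀ u ∈ Set.Icc (-r) r,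
      DifferentiableAt ℝ (iotaDeriv P g ε i q (past ε i ω)) u)
    (hEq : ∀ᵐ ω ∂P, ∀ q ≤ p, ∀ u ∈ Set.Icc (-r) r,
      iotaVersion P g ε q (past ε i ω, u) = iotaDeriv P g ε i q (past ε i ω) u)
    {q : ℕ} (hq : q < p)
    (hbdd : (⨆ u ∈ Set.Icc (-r) r,
      eLpNorm (fun ω => iotaDeriv P g ε i (q + 1) (past ε i ω) u) 2 P) < ∞)
    (hint : ∀ u ∈ Set.Icc (-r) r, Integrable (fun h => iotaVersion P g ε q (h, u)) Q) :
    ∀ᵐ ω ∂P, IntegrableOn (fun u => centred P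
        (fun x => iotaVersion P g ε (q + 1) (past ε i x.1, x.2)) (ω, u)) (Set.Icc (-r) r) ∧
      ∀ x ∈ Set.Icc (-r) r, ∀ y ∈ Set.Icc (-r) r,
        ∫ v in x..y, centred P (fun x => iotaVersion P g ε (q + 1) (past ε i x.1, x.2)) (ω, v)
          = centred P (fun x => iotaVersion P g ε q (past ε i x.1, x.2)) (ω, y)
            - centred P (fun x => iotaVersion P g ε q (past ε i x.1, x.2)) (ω, x) := by
  have hpm : Measurable fun x : Ω × ℝ => (past ε i x.1, x.2) :=
    ((measurable_past hε i).comp measurable_fst).prodMk measurable_snd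
  refine centred_integral_eq ?_ ?_ ?_
  · refine integrable_prod_of_eLpNorm_le ((measurable_iotaVersion _).comp hpm) hbdd.ne
      fun u hu => ?_
    refine le_trans (le_of_eq (eLpNorm_congr_ae ?_)) (le_iSup₂ (f := fun u (_ : u ∈ Set.Icc (-r) r) =>
      eLpNorm (fun ω => iotaDeriv P g ε i (q + 1) (past ε i ω) u) 2 P) u hu)
    filter_upwards [hEq] with ω hω
    exact hω (q + 1) hq u hu
  · intro u hu
    have h := hint u hu
    rw [← hQ i] at h
    exact h.comp_measurable (measurable_past hε i)
  · filter_upwards [hdiff, hEq] with ω hd he hi x hx y hy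
    have hsub : Set.uIcc x y ⊆ Set.Icc (-r) r := Set.uIcc_subset_Icc hx hy
    rw [he q hq.le y hy, he q hq.le x hx]
    rw [intervalIntegral.integral_congr (g := iotaDeriv P g ε i (q + 1) (past ε i ω))
      fun v hv => he (q + 1) hq v (hsub hv)]
    refine intervalIntegral.integral_eq_sub_of_hasDerivAt (fun v hv => ?_) ?_
    · have h := (hd q hq v (hsub hv)).hasDerivAt
      have h' : deriv (iotaDeriv P g ε i q (past ε i ω)) v
          = iotaDeriv P g ε i (q + 1) (past ε i ω) v := by
        unfold iotaDeriv
        rw [iteratedDeriv_succ]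
      rw [h'] at h
      exact h
    · refine intervalIntegrable_iff.2 ?_
      refine (hi.mono_set (Set.uIoc_subset_uIcc.trans hsub)).congr_fun (fun v hv => ?_)
        measurableSet_uIoc
      exact he (q + 1) hq v (hsub (Set.uIoc_subset_uIcc hv))

/-- The bound for the increments of the remainder at a fixed sample size. -/
theorem eLpNorm_iSup_remainder_sub_le (hε : ∀ k, Measurable (ε k)) (hε' : Measurable ε')
    (hindep : iIndepFun ε P) (hindep' : IndepFun ε' (fun ω k => ε k ω) P)
    {Q : Measure (ℕ → S)} (hQ : ∀ i, P.map (past ε i) = Q) (hg : Measurable g) (hr : 0 < r)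
    (hdiff : ∀ i : ℕ, ∀ᵐ ω ∂P, ∀ q < p, ∀ u ∈ Set.Icc (-r) r,
      DifferentiableAt ℝ (iotaDeriv P g ε i q (past ε i ω)) u)
    (hbdd : ∀ i : ℕ, ∀ q ∈ Finset.Icc 1 p, (⨆ u ∈ Set.Icc (-r) r,
      eLpNorm (fun ω => iotaDeriv P g ε i q (past ε i ω) u) 2 P) < ∞)
    {K : ℝ≥0∞} (hK : ∀ q ∈ Finset.Icc 1 p, ∑' m : ℕ, ⨆ u ∈ Set.Icc (-r) r,
      eLpNorm (predictiveGap P g ε ε' q m u) 2 P ≤ K)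
    (a : ℝ) {n : ℕ} {γ : ℕ → ℝ} {c₁ : ℝ} (hc₁ : 0 < c₁)
    (hγ : ∀ i ∈ Finset.Icc 1 n, c₁ ≤ γ i) (z : ℕ → EuclideanSpace ℝ (Fin p))
    {δ ρ : ℝ} (hδ : 0 ≤ δ) (hρ : 0 ≤ ρ) (hz : ∀ i ∈ Finset.Icc 1 n, ‖z i‖ / c₁ ≤ ρ)
    (hδρ : δ * (p * ρ) ≤ r) :
    eLpNorm (fun ω => ⨆ φ ∈ Metric.closedBall (0 : EuclideanSpace ℝ (Fin p)) δ,
        ‖remainder P g ε a n γ z φ ω - remainder P g ε a n γ z 0 ω‖ₑ) 2 P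
      ≤ ENNReal.ofReal (p * (p * (2 * δ * (√(nu n z 4) / c₁) * (1 + 2 * δ * ρ) ^ p))) * K := by
  have hlaw := condLaw_eq (P := P) hε hQ hg
  have hEq : ∀ i : ℕ, ∀ᵐ ω ∂P, ∀ q ≤ p, ∀ u ∈ Set.Icc (-r) r,
      iotaVersion P g ε q (past ε i ω, u) = iotaDeriv P g ε i q (past ε i ω) u :=
    fun i => iotaVersion_ae_eq hr (hlaw i) (hdiff i)
  have hprobQ : IsProbabilityMeasure Q := by
    rw [← hQ 0]; exact Measure.isProbabilityMeasure_map (measurable_past hε 0).aemeasurable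
  have hγ0 : ∀ i ∈ Finset.Icc 1 n, 0 < γ i := fun i hi => hc₁.trans_le (hγ i hi)
  have hmem : ∀ q, 1 ≤ q → q ≤ p → ∀ u ∈ Set.Icc (-r) r,
      MemLp (fun h => iotaVersion P g ε q (h, u)) 2 Q := fun q h1 h2 u hu =>
    memLp_iotaVersion hε hQ hEq h2 (hbdd 0 q (Finset.mem_Icc.2 ⟨h1, h2⟩)) hu
  have hint : ∀ q ≤ p, ∀ u ∈ Set.Icc (-r) r,
      Integrable (fun h => iotaVersion P g ε q (h, u)) Q := by
    intro q hq u hu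
    -- Order zero has no moment assumption, but a tail probability is at most one.
    rcases Nat.eq_zero_or_pos q with rfl | h1
    · refine Integrable.of_bound (C := 1) ((measurable_iotaVersion 0).comp
        measurable_prodMk_right).aestronglyMeasurable (ae_of_all _ fun h => ?_)
      have := iota_mem_Icc (P := P) g ε 0 h u
      rw [Real.norm_eq_abs, abs_le]
      exact ⟨by linarith [this.1, show iotaVersion P g ε 0 (h, u) = iota P g ε 0 h u from rfl],
        this.2⟩
    · exact (hmem q h1 hq u hu).integrable (by norm_num)
  set Y : ℕ → ℕ → Ω × ℝ → ℝ := fun q i =>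
    centred P fun x => iotaVersion P g ε q (past ε ((i : ℤ) - 1) x.1, x.2) with hY
  have hYm : ∀ q i, Measurable (Y q i) := fun q i => measurable_centred P
    ((measurable_iotaVersion q).comp
      (((measurable_past hε _).comp measurable_fst).prodMk measurable_snd))
  set b : ℕ → ℕ → ℝ := fun i j => coord (z i) j / γ i with hb
  have hbz : ∀ i ∈ Finset.Icc 1 n, ∀ j, |b i j| ≤ ‖z i‖ / c₁ := by
    intro i hi j
    rw [hb, abs_div, abs_of_pos (hγ0 i hi)]
    gcongr
    · exact abs_coord_le _ _
    · exact hγ i hi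
  have hYK : ∀ q, 1 ≤ q → q ≤ p → ∀ c w : ℕ → ℝ, (∀ i ∈ Finset.Icc 1 n, |w i| ≤ r) →
      eLpNorm (fun ω => ∑ i ∈ Finset.Icc 1 n, c i * Y q i (ω, w i)) 2 P
        ≤ ENNReal.ofReal √(∑ i ∈ Finset.Icc 1 n, c i ^ 2) * K := fun q h1 h2 c w hw =>
    (eLpNorm_sum_centred_le hε hε' hindep hindep' hQ hEq h2 (hmem q h1 h2) _ c w hw).trans
      (mul_le_mul_right (hK q (Finset.mem_Icc.2 ⟨h1, h2⟩)) _)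
  have hae : ∀ᵐ ω ∂P, ∀ q < p, ∀ i ∈ Finset.Icc 1 n,
      IntegrableOn (fun u => Y (q + 1) i (ω, u)) (Set.Icc (-r) r) ∧
      ∀ x ∈ Set.Icc (-r) r, ∀ y ∈ Set.Icc (-r) r,
        ∫ v in x..y, Y (q + 1) i (ω, v) = Y q i (ω, y) - Y q i (ω, x) := by
    refine ae_all_iff.2 fun q => eventually_imp_distrib_left.2 fun hq => ?_
    refine ae_all_iff.2 fun i => eventually_imp_distrib_left.2 fun hi => ?_
    -- The sum starts at `i = 1`, so the conditioning time `i - 1` is a natural number, as the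
    -- assumptions on derivatives require.
    obtain ⟨k, rfl⟩ : ∃ k, i = k + 1 := ⟨i - 1, by have := Finset.mem_Icc.1 hi; omega⟩
    have h := ae_centred_integral_eq hε hQ (hdiff k) (hEq k) hq
      (hbdd k (q + 1) (Finset.mem_Icc.2 ⟨by omega, hq⟩)) (hint q hq.le)
    have hk : (((k + 1 : ℕ) : ℤ) - 1) = (k : ℤ) := by push_cast; ring
    simp only [hY, hk]
    exact h
  have hV : ∀ (l : Fin p), ∀ j < p,
      √(∑ i ∈ Finset.Icc 1 n, (z i l * b i j) ^ 2) ≤ √(nu n z 4) / c₁ := by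
    intro l j _
    rw [← Real.sqrt_sq hc₁.le, ← Real.sqrt_div' _ (sq_nonneg c₁)]
    apply Real.sqrt_le_sqrt
    rw [nu, Finset.sum_div]
    refine Finset.sum_le_sum fun i hi => ?_
    have h1 : |z i l| ≤ ‖z i‖ := PiLp.norm_apply_le (z i) l
    have h2 := hbz i hi j
    calc (z i l * b i j) ^ 2 = |z i l| ^ 2 * |b i j| ^ 2 := by rw [sq_abs, sq_abs, mul_pow]
      _ ≤ ‖z i‖ ^ 2 * (‖z i‖ / c₁) ^ 2 := by gcongr
      _ = ‖z i‖ ^ 4 / c₁ ^ 2 := by ring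
  have hmaj := fun l : Fin p => exists_majorant_increment (P := P) (s := Finset.Icc 1 n) (a := b)
    hYm hδ hρ hYK hae (fun i hi j _ => (hbz i hi j).trans (hz i hi)) hδρ (fun i => z i l) (hV l)
  choose W hWm hWb hWn using hmaj
  have hrem : ∀ φ ω l, (remainder P g ε a n γ z φ ω - remainder P g ε a n γ z 0 ω) l
      = ∑ i ∈ Finset.Icc 1 n, z i l *
        (Y 0 i (ω, ∑ j ∈ Finset.range p, coord φ j * b i j) - Y 0 i (ω, 0)) := by
    intro φ ω l
    rw [remainder_eq hε hg a hγ0, remainder_eq hε hg a hγ0, ← Finset.sum_sub_distrib]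
    simp only [inner_zero_right, zero_div, ← sub_smul]
    rw [WithLp.ofLp_sum, Finset.sum_apply]
    refine Finset.sum_congr rfl fun i _ => ?_
    have hiota : iota P g ε ((i : ℤ) - 1) = iota P g ε 0 := by
      ext h u; simp only [iota, hlaw]
    rw [PiLp.smul_apply, smul_eq_mul, mul_comm, inner_div_eq_sum_coord, hiota]
    rfl
  calc eLpNorm (fun ω => ⨆ φ ∈ Metric.closedBall (0 : EuclideanSpace ℝ (Fin p)) δ,
        ‖remainder P g ε a n γ z φ ω - remainder P g ε a n γ z 0 ω‖ₑ) 2 P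
      ≤ eLpNorm (∑ l, W l) 2 P := by
        -- Monotonicity needs no measurability of the uncountable supremum.
        refine eLpNorm_mono_enorm_ae ?_
        filter_upwards [ae_all_iff.2 hWb] with ω hω
        simp only [enorm_eq_self, Finset.sum_apply]
        refine iSup₂_le fun φ hφ => (enorm_le_sum_enorm _).trans (Finset.sum_le_sum fun l _ => ?_)
        rw [hrem]
        exact hω l _ fun j => (abs_coord_le φ j).trans (mem_closedBall_zero_iff.1 hφ)
    _ ≤ ∑ l, eLpNorm (W l) 2 P :=
        eLpNorm_sum_le (fun l _ => (hWm l).aestronglyMeasurable) (by norm_num)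
    _ ≤ ∑ _l : Fin p, ENNReal.ofReal
          (p * (2 * δ * (√(nu n z 4) / c₁) * (1 + 2 * δ * ρ) ^ p)) * K :=
        Finset.sum_le_sum fun l _ => hWn l
    _ = _ := by
        rw [Finset.sum_const, Finset.card_univ, Fintype.card_fin, nsmul_eq_mul, ← mul_assoc,
          ENNReal.ofReal_mul (p := (p : ℝ)) (q := p * _) (Nat.cast_nonneg p),
          ENNReal.ofReal_natCast]

end Remainder

end HighQuantile

/-! ### Asymptotic statement -/

open HighQuantile in
theorem lemma2 {Ω S : Type*} [MeasurableSpace Ω] [MeasurableSpace S]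
    (P : Measure Ω) [IsProbabilityMeasure P]
    -- i.i.d. innovations and an independent copy of the one at time zero
    (ε : ℤ → Ω → S) (ε' : Ω → S)
    (hε_meas : ∀ k, Measurable (ε k)) (hε'_meas : Measurable ε')
    (hε_indep : iIndepFun ε P) (hε_ident : ∀ k, IdentDistrib (ε k) (ε 0) P P)
    (hε'_ident : IdentDistrib ε' (ε 0) P P)
    (hε'_indep : IndepFun ε' (fun ω k => ε k ω) P)
    -- the systems, with `e_{i,n} = G_n(ℱ_i)`
    (G : ℕ → (ℕ → S) → ℝ) (hG : ∀ n, Measurable (G n))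
    -- the quantile levels
    (α : ℕ → ℝ) (hα : Tendsto α atTop (𝓝 0))
    (hnα : Tendsto (fun n : ℕ => (n : ℝ) * α n) atTop atTop)
    -- the design
    (p : ℕ) (x : ℕ → ℕ → EuclideanSpace ℝ (Fin p))
    (hx : ∀ᶠ n in atTop, IsUnit (gram n (x n)))
    -- the scales
    (γ : ℕ → ℕ → ℝ) (c₁ c₂ : ℝ) (hc₁ : 0 < c₁)
    (hγ : ∀ᶠ n in atTop, ∀ i ∈ Finset.Icc 1 n, c₁ ≤ γ n i ∧ γ n i ≤ c₂)
    -- existence of the derivatives of the conditional tail probability near zero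
    (ε₀ : ℝ) (hε₀ : 0 < ε₀)
    (hdiff : ∀ᶠ n in atTop, ∀ i : ℕ, ∀ᵐ ω ∂P, ∀ q < p, ∀ u ∈ Set.Icc (-ε₀) ε₀,
      DifferentiableAt ℝ (iotaDeriv P (G n) ε i q (past ε i ω)) u)
    -- their uniform square integrability
    (hbdd : ∀ᶠ n in atTop, ∀ i : ℕ, ∀ q ∈ Finset.Icc 1 p,
      (⨆ u ∈ Set.Icc (-ε₀) ε₀,
        eLpNorm (fun ω => iotaDeriv P (G n) ε i q (past ε i ω) u) 2 P) < ∞)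
    -- predictive stability
    (hstab : ∀ q ∈ Finset.Icc 1 p, ∃ C : ℝ, ∀ᶠ n in atTop,
      (∑' i : ℕ, ⨆ u ∈ Set.Icc (-ε₀) ε₀, eLpNorm (predictiveGap P (G n) ε ε' q i u) 2 P)
        ≤ ENNReal.ofReal (C * √(α n)))
    (δ : ℕ → ℝ) (hδ : ∀ n, 0 < δ n)
    (hδr : Tendsto (fun n => δ n * maxNorm n (rescaled n (x n))) atTop (𝓝 0)) :
    ∃ C : ℝ, ∀ᶠ n in atTop,
      eLpNorm (fun ω => ⨆ φ ∈ Metric.closedBall (0 : EuclideanSpace ℝ (Fin p)) (δ n),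
          ‖remainder P (G n) ε (α n) n (γ n) (rescaled n (x n)) φ ω
            - remainder P (G n) ε (α n) n (γ n) (rescaled n (x n)) 0 ω‖ₑ) 2 P
        ≤ ENNReal.ofReal (C * (δ n * √(α n * nu n (rescaled n (x n)) 4))) := by
  have hQ : ∀ i, P.map (past ε i) = Measure.infinitePi fun _ : ℕ => P.map (ε 0) :=
    map_past hε_meas hε_indep fun k => (hε_ident k).map_eq
  obtain ⟨C, hC0, hC⟩ : ∃ C : ℝ, 0 ≤ C ∧ ∀ᶠ n in atTop, ∀ q ∈ Finset.Icc 1 p,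
      (∑' i : ℕ, ⨆ u ∈ Set.Icc (-ε₀) ε₀, eLpNorm (predictiveGap P (G n) ε ε' q i u) 2 P)
        ≤ ENNReal.ofReal (C * √(α n)) := by
    choose! C hC using hstab
    refine ⟨∑ q ∈ Finset.Icc 1 p, |C q|, Finset.sum_nonneg fun q _ => abs_nonneg _, ?_⟩
    refine (Finset.eventually_all _).2 fun q hq => ?_
    filter_upwards [hC q hq] with n hn
    refine hn.trans (ENNReal.ofReal_le_ofReal ?_)
    gcongr
    exact (le_abs_self _).trans
      (Finset.single_le_sum (f := fun q => |C q|) (fun q _ => abs_nonneg _) hq)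
  set R : ℕ → ℝ := fun n => maxNorm n (rescaled n (x n)) with hR
  have hρ : Tendsto (fun n => δ n * (R n / c₁)) atTop (𝓝 0) := by
    have h := hδr.div_const c₁
    rw [zero_div] at h
    exact h.congr fun n => by rw [mul_div_assoc]
  have hpρ : Tendsto (fun n => δ n * (p * (R n / c₁))) atTop (𝓝 0) := by
    have h := hρ.const_mul (p : ℝ)
    rw [mul_zero] at h
    exact h.congr fun n => by ring
  -- One `p` counts coordinates of the remainder, the other those of `φ`; `2` comes from the length
  -- of `[-δ, δ]`, `c₁` from dividing by the scales, and `3 ^ p` from `δ_n r_n / c₁ ≤ 1`.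
  refine ⟨p * (p * (2 * 3 ^ p / c₁)) * C, ?_⟩
  filter_upwards [hC, hdiff, hbdd, hγ, hρ.eventually_le_const one_pos,
    hpρ.eventually_le_const hε₀] with n hCn hdn hbn hγn h1 h2
  have hR0 : 0 ≤ R n := NNReal.coe_nonneg _
  have hν : 0 ≤ nu n (rescaled n (x n)) 4 := Finset.sum_nonneg fun i _ => by positivity
  refine (eLpNorm_iSup_remainder_sub_le hε_meas hε'_meas hε_indep hε'_indep hQ (hG n) hε₀ hdn hbn
    hCn (α n) hc₁ (fun i hi => (hγn i hi).1) (rescaled n (x n)) (hδ n).le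
    (ρ := R n / c₁) (by positivity) (fun i hi => ?_) h2).trans ?_
  · gcongr
    exact NNReal.coe_le_coe.2 (Finset.le_sup (f := fun i => ‖rescaled n (x n) i‖₊) hi)
  · have hδn := (hδ n).le
    rw [← ENNReal.ofReal_mul (by positivity)]
    apply ENNReal.ofReal_le_ofReal
    have h3 : (1 + 2 * δ n * (R n / c₁)) ^ p ≤ 3 ^ p := by
      gcongr
      linarith
    rw [Real.sqrt_mul' _ hν]
    calc (p * (p * (2 * δ n * (√(nu n (rescaled n (x n)) 4) / c₁)
            * (1 + 2 * δ n * (R n / c₁)) ^ p))) * (C * √(α n))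
        ≤ (p * (p * (2 * δ n * (√(nu n (rescaled n (x n)) 4) / c₁) * 3 ^ p)))
            * (C * √(α n)) := by gcongr
      _ = _ := by ring
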